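/- **Setting.** Let $\boldsymbol M$ (nodes) and $\boldsymbol P$ (chains) be finite sets. Each chain $p\in\boldsymbol P$ has a frequency $n_p\in\{1,2,\dots\}$ and a phase $\theta_p\in[0,1/n_p)$; put $\mathcal D_p=\theta_p+\frac1{n_p}\mathbb Z$, let $\mu_p$ (as a measure, written $d\mu_p(k)$) be the counting measure on $\mathcal D_p$, and $\mathcal Q=\{(p,k):p\in\boldsymbol P,\ k\in\mathcal D_p\}$. On a probability space let $\pi^m$ ($m\in\boldsymbol M$) be independent Poisson random measures on $\mathbb R\times\mathbb R_+$ with Lebesgue intensity, all of whose atoms have distinct time coordinates, and let $\xi^p_k$ ($(p,k)\in\mathcal Q$) be independent real random variables (random drifts), independent of the $\pi^m$, with $\xi^p_k\sim\xi^p_{k+n}$ for $n\in\mathbb Z$. Let $\mathcal F_t$ be generated by the $\pi^m$ on $(-\infty,t]\times\mathbb R_+$ and the $\xi^p_k$ with $k\le t$. Parameters $\mathfrak M$ consist of base rates $\mu_m$, measurable interaction functions $h^\alpha_\beta:(0,\infty)\to\mathbb R$, Lipschitz link functions $\Phi^\alpha$ (nondecreasing if $\alpha\in\boldsymbol M$,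 with $\Phi^\alpha(0)=0$ if $\alpha\in\boldsymbol P$) and Lipschitz masks $\kappa^\alpha_p$, for $\alpha,\beta\in\boldsymbol M\cup\boldsymbol P$, $p\in\boldsymbol P$. They are *linear* ($\mathfrak M\in\mathfrak L$) if every $\Phi^\alpha$ is the identity (for a node, the positive part $x\mapsto\max(x,0)$ is also allowed), $\kappa^\alpha_p(x)=a^\alpha_px+b^\alpha_p$ with $a^\alpha_p,b^\alpha_p\ge0$, $h^\alpha_\beta\ge0$ and $\mu_m\ge0$. For $t_0\in\{-\infty\}\cup\mathbb R$, a HAR process with parameters $\mathfrak M$ started at $t_0$ with empty initial condition is an adapted triple $(\lambda,S,W)$ with $\lambda$ predictable, $S^m\subset[t_0,\infty)$, such that, the integrals being convergent, $$\lambda^m_t=\Phi^m\Big(\mu_m+\sum_{m'}\int_{t_0}^{t-}h^m_{m'}(t-s)\,dS^{m'}_s+\sum_p\int_{t_0}^{t-}h^m_p(t-k)\kappa^m_p(W^p_k)\,d\mu_p(k)\Big)$$ for $\mathbb P\otimes dt$-almost every $(\omega,t)$ with $t\ge t_0$; almost surely $S^m(C)=\int_{C\times\mathbb R_+}\mathbf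 1_{x\le\lambda^m_s}\,d\pi^m(s,x)$ for all $C\subset[t_0,\infty)$; and almost surely, for all $(p,k)\in\mathcal Q$ with $k\ge t_0$, $$W^p_k=\xi^p_k+\Phi^p\Big(\sum_m\int_{t_0}^{k-}h^p_m(k-s)\,dS^m_s+\sum_{p'}\int_{t_0}^{k-}h^p_{p'}(k-k')\kappa^p_{p'}(W^{p'}_{k'})\,d\mu_{p'}(k')\Big).$$ Let $\|f\|_{1,n}^\infty=\sup_{x\in\mathbb R}\sum_{k\in\mathbb Z}|f(x+k/n)|$ ($f$ extended by $0$ to $(-\infty,0]$) and write $L_\alpha$, $a^\alpha_p$ for the Lipschitz constants of $\Phi^\alpha$, $\kappa^\alpha_p$. Let $H_{\mathfrak M}$ be the matrix indexed by $\boldsymbol M\cup\boldsymbol P$ with entries $L_\alpha\|h^\alpha_m\|_1$ (column $m\in\boldsymbol M$) and $L_\alpha a^\alpha_p\|h^\alpha_p\|_{1,n_p}^\infty$ (column $p\in\boldsymbol P$), with the convention $0\cdot\infty=\infty$, and let $H^W_W$ be its $\boldsymbol P\times\boldsymbol P$ block. Assumptions: (NoExpl) the functions $h^m_{m'},h^m_p,h^p_m$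 ($m,m'\in\boldsymbol M$, $p\in\boldsymbol P$) are in $L^1$; (Spec1) $H_{\mathfrak M}$ has finite entries and spectral radius $<1$; (Spec1.1) the same for $H^W_W$; (FiMe) $\sup_{\mathcal Q}\mathbb E|\xi^p_k|<\infty$. For $\mathfrak M\in\mathfrak L$ and $(p,k),(p',k')\in\mathcal Q$ with $k'\le k$, the recursion coefficients are defined by $C^{p,k}_{p',k}=\mathbf 1_{p=p'}$ and, for $k'<k$, $C^{p,k}_{p',k'}=\sum_{p''}\int_{k'}^{k-}a^p_{p''}h^p_{p''}(k-k'')\,C^{p'',k''}_{p',k'}\,d\mu_{p''}(k'')$. Put $$\mathbb H^b_{p,k}(t_0)=\sum_{p'}\int_{t_0}^kC^{p,k}_{p',k'}\Big[\sum_{p''}b^{p'}_{p''}\int_{t_0}^{k'-}h^{p'}_{p''}(k'-k'')\,d\mu_{p''}(k'')\Big]d\mu_{p'}(k'),$$ $$\mathbb H^\xi_{p,k}(t_0)=\sum_{p'}\int_{t_0}^kC^{p,k}_{p',k'}\,\xi^{p'}_{k'}\,d\mu_{p'}(k'),\qquad \mathbb H^m_{p,k}(t_0,t)=\sum_{p'}\int_{t_0}^kC^{p,k}_{p',k'}\mathbf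 1_{t<k'}h^{p'}_m(k'-t)\,d\mu_{p'}(k').$$ **Theorem (cluster representation for linear HAR processes).** Let $\mathfrak M\in\mathfrak L$ and suppose that almost surely $\xi^p_k\ge0$ for all $(p,k)\in\mathcal Q$. Let $(\lambda,S,W)$ be a HAR process with parameters $\mathfrak M$ started at $t_0$ with empty initial condition. If $t_0\in\mathbb R$, suppose (NoExpl) and that the process is non-exploding (almost surely each $S^m$ has finitely many points in every bounded set); if $t_0=-\infty$, suppose (Spec1), (FiMe), $\sup_{m,t}\mathbb E|\lambda^m_t|<\infty$ and $\sup_{\mathcal Q}\mathbb E|W^p_k|<\infty$. Then almost surely, for all $(p,k)\in\mathcal Q$ with $k\ge t_0$, $W^p_k\ge 0$ and $$W^p_k=\mathbb H^b_{p,k}(t_0)+\mathbb H^\xi_{p,k}(t_0)+\sum_m\int_{t_0}^{k-}\mathbb H^m_{p,k}(t_0,t)\,dS^m_t,$$ and for all $m\in\boldsymbol M$ and $\mathbb P\otimes dt$-almost every $(\omega,t)$ with $t\ge t_0$, $\lambda^m_t\ge0$ and $$\lambda^m_t=\mathcal I^m(t_0,t)+\sum_{m'}\int_{t_0}^{t-}\mathfrak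 h^m_{m'}(s,t)\,dS^{m'}_s,$$ where, for $s<t$, $$\mathfrak h^m_{m_0}(s,t)=h^m_{m_0}(t-s)+\sum_{p,p'}\int_{s+}^{t-}\int_{s+}^{k}a^m_ph^m_p(t-k)\,C^{p,k}_{p',k'}\,h^{p'}_{m_0}(k'-s)\,d\mu_{p'}(k')\,d\mu_p(k),$$ $$\mathcal I^m(t_0,t)=\mu_m+\sum_p\int_{t_0}^{t-}h^m_p(t-k)\big(a^m_p\mathbb H^b_{p,k}(t_0)+a^m_p\mathbb H^\xi_{p,k}(t_0)+b^m_p\big)\,d\mu_p(k),$$ all the series and integrals being convergent sums of nonnegative terms. The cluster functions are 1-periodic: $\mathfrak h^m_{m_0}(s+1,t+1)=\mathfrak h^m_{m_0}(s,t)$. Finally, (Spec1) implies (Spec1.1), and under (Spec1.1), for all $m,m_0\in\boldsymbol M$ and $s\in\mathbb R$, $$\int_s^\infty\mathfrak h^m_{m_0}(s,t)\,dt\le\|h^m_{m_0}\|_1+\sum_{p,p'}n_p\,a^m_p\,\|h^m_p\|_1\big[(\mathrm{Id}-H^W_W)^{-1}\big]_{p,p'}\|h^{p'}_{m_0}\|_{1,1}^\infty$$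 (in $[0,\infty]$, where on the right $0\cdot\infty=0$). -/

import Mathlib

open MeasureTheory ProbabilityTheory Set
open scoped ENNReal NNReal

namespace HAR

/-! ### Time grids of the chains -/

/-- Frequencies `n p ≥ 1` and phases `θ p ∈ [0, 1 / n p)` of the chains `p : P`. -/
structure Grid (P : Type*) where
  n : P → ℕ
  n_pos : ∀ p, 0 < n p
  θ : P → ℝ
  θ_nonneg : ∀ p, 0 ≤ θ p
  θ_lt : ∀ p, θ p < 1 / (n p : ℝ)

/-- The set `𝒬` of pairs `(p, k)` with `k ∈ 𝒟_p = θ_p + (1 / n_p) ℤ` is parametrized by `P × ℤ`: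
the index `(p, j)` stands for `(p, k)` with `k = θ_p + j / n_p`, and `time` returns `k`. A sum
`∑_p ∫ … dμ_p(k)` against the counting measures of the `𝒟_p` is a sum over `P × ℤ`. -/
noncomputable def Grid.time {P : Type*} (G : Grid P) (q : P × ℤ) : ℝ :=
  G.θ q.1 + (q.2 : ℝ) / (G.n q.1 : ℝ)

/-- Only finitely many grid times lie in a bounded window. -/
theorem Grid.finite_Ico {P : Type*} [Finite P] (G : Grid P) (a b : ℝ) :
    {r : P × ℤ | a ≤ G.time r ∧ G.time r < b}.Finite := by
  have key : ∀ p : P, {j : ℤ | a ≤ G.time (p, j) ∧ G.time (p, j) < b}.Finite := by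
    intro p
    have hn : (0 : ℝ) < G.n p := by exact_mod_cast G.n_pos p
    refine (Set.finite_Icc ⌊(a - G.θ p) * G.n p⌋ ⌈(b - G.θ p) * G.n p⌉).subset ?_
    rintro j ⟨h1, h2⟩
    simp only [Grid.time] at h1 h2
    have h1' : (a - G.θ p) * G.n p ≤ j := by
      rw [← le_div_iff₀ hn]; linarith
    have h2' : (j : ℝ) ≤ (b - G.θ p) * G.n p := by
      rw [← div_le_iff₀ hn]; linarith
    constructor
    · exact_mod_cast (Int.floor_le _).trans h1'
    · exact_mod_cast h2'.trans (Int.le_ceil _)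
  refine (Set.finite_iUnion fun p => (key p).image (Prod.mk p)).subset ?_
  rintro ⟨p, j⟩ h
  exact Set.mem_iUnion.2 ⟨p, j, h, rfl⟩

/-! ### Parameters -/

/-- The (smallest) Lipschitz constant of a Lipschitz function. -/
noncomputable def lip (f : ℝ → ℝ) : ℝ≥0 := sInf {K : ℝ≥0 | LipschitzWith K f}

/-- Parameters of a HAR process with set of nodes `N` and set of chains `P`; an element of
`N ⊕ P` is a node or a chain. `h α β` is a function on `(0, ∞)`: only its values at positive
arguments are ever used. Nonnegativity of the link functions of the nodes is not imposed, so
that linear parameters may have the identity as link function. -/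
structure Params (N P : Type*) where
  μ : N → ℝ
  h : N ⊕ P → N ⊕ P → ℝ → ℝ
  Φ : N ⊕ P → ℝ → ℝ
  κ : N ⊕ P → P → ℝ → ℝ
  measurable_h : ∀ α β, Measurable (h α β)
  lipschitz_Φ : ∀ α, ∃ K : ℝ≥0, LipschitzWith K (Φ α)
  lipschitz_κ : ∀ α p, ∃ K : ℝ≥0, LipschitzWith K (κ α p)
  monotone_Φ : ∀ m, Monotone (Φ (Sum.inl m))
  Φ_zero : ∀ p, Φ (Sum.inr p) 0 = 0

/-- `‖f‖₁` for a function on `(0, ∞)`. -/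
noncomputable def normL1 (f : ℝ → ℝ) : ℝ≥0∞ := ∫⁻ x in Ioi (0 : ℝ), ‖f x‖ₑ

open Classical in
/-- `‖f‖_{1,n}^∞ = sup_x ∑_{k ∈ ℤ} |f (x + k / n)|` for a function on `(0, ∞)`, extended by `0`. -/
noncomputable def normLattice (f : ℝ → ℝ) (n : ℕ) : ℝ≥0∞ :=
  ⨆ x : ℝ, ∑' k : ℤ, if 0 < x + (k : ℝ) / (n : ℝ) then ‖f (x + (k : ℝ) / (n : ℝ))‖ₑ else 0

namespace Params

variable {N P : Type*}

/-- `a^α_p`, the Lipschitz constant of the mask `κ^α_p`. -/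
noncomputable def a (M : Params N P) (α : N ⊕ P) (p : P) : ℝ := (lip (M.κ α p) : ℝ)

/-- `b^α_p`, the value of the mask `κ^α_p` at `0`. -/
def b (M : Params N P) (α : N ⊕ P) (p : P) : ℝ := M.κ α p 0

/-- The norm of `h^α_β` that enters the interaction matrix: `‖·‖₁` if `β` is a node and
`‖·‖_{1,n_β}^∞` if `β` is a chain. -/
noncomputable def hNorm (M : Params N P) (G : Grid P) (α : N ⊕ P) : N ⊕ P → ℝ≥0∞
  | Sum.inl m => normL1 (M.h α (Sum.inl m))
  | Sum.inr p => normLattice (M.h α (Sum.inr p)) (G.n p)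

/-- The interaction matrix `H_𝔐`, of use only when all the norms `hNorm` are finite. -/
noncomputable def H (M : Params N P) (G : Grid P) : Matrix (N ⊕ P) (N ⊕ P) ℝ := fun α β =>
  match β with
  | Sum.inl m => (lip (M.Φ α) : ℝ) * (M.hNorm G α (Sum.inl m)).toReal
  | Sum.inr p => (lip (M.Φ α) : ℝ) * M.a α p * (M.hNorm G α (Sum.inr p)).toReal

/-- The block `H^W_W` of the interaction matrix. -/
noncomputable def HWW (M : Params N P) (G : Grid P) : Matrix P P ℝ := (M.H G).toBlocks₂₂

/-- Assumption (NoExpl). -/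
def NoExpl (M : Params N P) : Prop :=
  (∀ m, ∃ K : ℝ≥0, LipschitzWith K (M.Φ (Sum.inl m))) ∧
  (∀ m m' : N, normL1 (M.h (Sum.inl m) (Sum.inl m')) ≠ ∞) ∧
  (∀ (m : N) (p : P), normL1 (M.h (Sum.inl m) (Sum.inr p)) ≠ ∞) ∧
  (∀ (p : P) (m : N), normL1 (M.h (Sum.inr p) (Sum.inl m)) ≠ ∞)

/-- Assumption (Spec1): `spr H_𝔐 < 1`. By the convention `0 × ∞ = ∞` for the entries of `H_𝔐`, the
norms of all the interaction functions are finite. -/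
def Spec1 [Fintype N] [Fintype P] [DecidableEq N] [DecidableEq P]
    (M : Params N P) (G : Grid P) : Prop :=
  (∀ α β, M.hNorm G α β ≠ ∞) ∧
    spectralRadius ℂ ((M.H G).map (fun x : ℝ => (x : ℂ))) < 1

/-- Assumption (Spec1.1): `spr H^W_W < 1`, with the same convention on infinite entries. -/
def Spec11 [Fintype P] [DecidableEq P] (M : Params N P) (G : Grid P) : Prop :=
  (∀ p p' : P, M.hNorm G (Sum.inr p) (Sum.inr p') ≠ ∞) ∧
    spectralRadius ℂ ((M.HWW G).map (fun x : ℝ => (x : ℂ))) < 1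

/-- The class `𝔏` of linear parameters. The link function of a node is the identity or, for the
reader who wants link functions of nodes to be nonnegative, its positive part. -/
structure IsLinear (M : Params N P) : Prop where
  link_node : ∀ m, M.Φ (Sum.inl m) = id ∨ M.Φ (Sum.inl m) = fun x => max x 0
  link_chain : ∀ p, M.Φ (Sum.inr p) = id
  mask : ∀ α p, ∃ a b : ℝ, 0 ≤ a ∧ 0 ≤ b ∧ ∀ x, M.κ α p x = a * x + b
  h_nonneg : ∀ α β x, 0 < x → 0 ≤ M.h α β x
  μ_nonneg : ∀ m, 0 ≤ M.μ m

end Params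

/-! ### Driving randomness -/

section Randomness

variable {Ω N P : Type*}

/-- The σ-algebra `σ(T ∩ A)` generated by the restriction to `A` of a random set of points `T`:
it is generated by the numbers of points in the Borel subsets of `A`. -/
@[reducible] noncomputable def sigmaPoints {E : Type*} [MeasurableSpace E] (T : Ω → Set E) (A : Set E) : MeasurableSpace Ω :=
  ⨆ B : {B : Set E // MeasurableSet B ∧ B ⊆ A},
    MeasurableSpace.comap (fun ω => (T ω ∩ B.1).encard) inferInstance

/-- Lebesgue measure on `ℝ × [0, ∞)`. -/
noncomputable def lebUpper : Measure (ℝ × ℝ) := volume.restrict (univ ×ˢ Ici 0)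

/-- `T`, a random set of points (the atoms), is a Poisson random measure on `ℝ × [0, ∞)` with
Lebesgue intensity. -/
structure IsPoissonRandomMeasure [MeasurableSpace Ω] (Pr : Measure Ω) (T : Ω → Set (ℝ × ℝ)) :
    Prop where
  subset : ∀ ω, T ω ⊆ univ ×ˢ Ici 0
  measurable : ∀ B, MeasurableSet B → Measurable fun ω => (T ω ∩ B).encard
  law : ∀ B, MeasurableSet B → lebUpper B ≠ ∞ → ∀ j : ℕ,
    Pr {ω | (T ω ∩ B).encard = j} = poissonMeasure (lebUpper B).toNNReal {j}
  indep : ∀ (l : ℕ) (B : Fin l → Set (ℝ × ℝ)), (∀ i, MeasurableSet (B i)) →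
    Pairwise (fun i j => Disjoint (B i) (B j)) → iIndepFun (fun i ω => (T ω ∩ B i).encard) Pr

/-- The driving randomness: independent Poisson random measures `π^m`, all of whose atoms have
distinct time coordinates, and independent random drifts `ξ^p_k`, independent of the `π^m`, whose
laws are 1-periodic in `k`. -/
structure IsDriving [MeasurableSpace Ω] (Pr : Measure Ω) (G : Grid P) (π : N → Ω → Set (ℝ × ℝ))
    (ξ : P × ℤ → Ω → ℝ) : Prop where
  poisson : ∀ m, IsPoissonRandomMeasure Pr (π m)
  measurable_ξ : ∀ q, Measurable (ξ q)
  indep : iIndep (Sum.elim (fun m : N => sigmaPoints (π m) univ)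
    (fun q : P × ℤ => MeasurableSpace.comap (ξ q) inferInstance)) Pr
  identDistrib : ∀ q q' : P × ℤ, q.1 = q'.1 → (∃ l : ℤ, G.time q' = G.time q + l) →
    IdentDistrib (ξ q) (ξ q') Pr Pr
  distinct_times : ∀ ω m m' s x x', (s, x) ∈ π m ω → (s, x') ∈ π m' ω → m = m' ∧ x = x'

/-- The σ-algebra `ℱ_t`. -/
@[reducible] noncomputable def history (G : Grid P) (π : N → Ω → Set (ℝ × ℝ)) (ξ : P × ℤ → Ω → ℝ) (t : ℝ) :
    MeasurableSpace Ω :=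
  (⨆ m : N, sigmaPoints (π m) (Iic t ×ˢ Ici 0)) ⊔
    ⨆ q : {q : P × ℤ // G.time q ≤ t}, MeasurableSpace.comap (ξ q.1) inferInstance

/-- The predictable σ-algebra on `Ω × ℝ` of a filtration indexed by `ℝ`, generated by the sets
`A × (s, t]` with `A ∈ ℱ_s`. -/
@[reducible] def predictableSigma (ℱ : ℝ → MeasurableSpace Ω) : MeasurableSpace (Ω × ℝ) :=
  MeasurableSpace.generateFrom
    {D | ∃ (s t : ℝ) (A : Set Ω), s < t ∧ MeasurableSet[ℱ s] A ∧ D = A ×ˢ Ioc s t}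

/-- Assumption (FiMe). -/
def FiMe [MeasurableSpace Ω] (Pr : Measure Ω) (ξ : P × ℤ → Ω → ℝ) : Prop :=
  ⨆ q, ∫⁻ ω, ‖ξ q ω‖ₑ ∂Pr < ∞

end Randomness

/-! ### HAR processes -/

/-- Points of `S` in `[t₀, t)`. The starting time `t₀` is real, or `⊥`, which stands for `-∞`. -/
def past (t₀ : WithBot ℝ) (t : ℝ) (S : Set ℝ) : Set ℝ := {s | s ∈ S ∧ t₀ ≤ (s : WithBot ℝ) ∧ s < t}

/-- The elements `(p, k)` of `𝒬` with `k ∈ [t₀, t)`. -/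
def Grid.past {P : Type*} (G : Grid P) (t₀ : WithBot ℝ) (t : ℝ) : Set (P × ℤ) :=
  {q | t₀ ≤ (G.time q : WithBot ℝ) ∧ G.time q < t}

/-- The elements `(p, k)` of `𝒬` with `k ∈ [t₀, t]`. -/
def Grid.pastClosed {P : Type*} (G : Grid P) (t₀ : WithBot ℝ) (t : ℝ) : Set (P × ℤ) :=
  {q | t₀ ≤ (G.time q : WithBot ℝ) ∧ G.time q ≤ t}

section Triples

variable {Ω N P : Type*}

/-- A candidate process: intensities `lam`, point sets `S` and chains `W`. -/
structure Triple (Ω N P : Type*) where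
  lam : N → ℝ → Ω → ℝ
  S : N → Ω → Set ℝ
  W : P × ℤ → Ω → ℝ

/-- The argument of the link function of `α` at time `t` (without the base rate): the sum of
`∫_{[t₀,t)} h^α_m (t - s) dS^m_s` over the nodes and of
`∫_{[t₀,t)} h^α_p (t - k) κ^α_p (W^p_k) dμ_p(k)` over the chains. -/
noncomputable def Triple.input [Fintype N] (X : Triple Ω N P) (G : Grid P) (M : Params N P)
    (t₀ : WithBot ℝ) (α : N ⊕ P) (t : ℝ) (ω : Ω) : ℝ :=
  (∑ m, ∑' s : past t₀ t (X.S m ω), M.h α (Sum.inl m) (t - s)) +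
    ∑' q : G.past t₀ t, M.h α (Sum.inr q.1.1) (t - G.time q) * M.κ α q.1.1 (X.W q ω)

/-- The integrals in `Triple.input` converge. -/
def Triple.InputConverges (X : Triple Ω N P) (G : Grid P) (M : Params N P)
    (t₀ : WithBot ℝ) (α : N ⊕ P) (t : ℝ) (ω : Ω) : Prop :=
  (∀ m, Summable fun s : past t₀ t (X.S m ω) => M.h α (Sum.inl m) (t - s)) ∧
    Summable fun q : G.past t₀ t =>
      M.h α (Sum.inr q.1.1) (t - G.time q) * M.κ α q.1.1 (X.W q ω)

/-- `X` is a HAR process with parameters `M` started at `t₀ ∈ {-∞} ∪ ℝ` with empty initial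
condition: no point before `t₀`, and the values of the chains before `t₀` play no role. That one of
the equations holds includes that the integrals in it converge. -/
structure IsHAR [MeasurableSpace Ω] [Fintype N] (Pr : Measure Ω) (G : Grid P)
    (π : N → Ω → Set (ℝ × ℝ)) (ξ : P × ℤ → Ω → ℝ) (M : Params N P) (t₀ : WithBot ℝ)
    (X : Triple Ω N P) : Prop where
  predictable : ∀ m,
    Measurable[predictableSigma (history G π ξ)] fun z : Ω × ℝ => X.lam m z.2 z.1
  adapted_S : ∀ m t, sigmaPoints (X.S m) (Iic t) ≤ history G π ξ t
  adapted_W : ∀ q, t₀ ≤ (G.time q : WithBot ℝ) → Measurable[history G π ξ (G.time q)] (X.W q)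
  init : ∀ᵐ ω ∂Pr, ∀ m, ∀ s ∈ X.S m ω, t₀ ≤ (s : WithBot ℝ)
  eq_lam : ∀ᵐ z ∂(Pr.prod (volume.restrict {t : ℝ | t₀ ≤ (t : WithBot ℝ)})), ∀ m,
    X.InputConverges G M t₀ (Sum.inl m) z.2 z.1 ∧
    X.lam m z.2 z.1 = M.Φ (Sum.inl m) (M.μ m + X.input G M t₀ (Sum.inl m) z.2 z.1)
  eq_S : ∀ᵐ ω ∂Pr, ∀ m, ∀ C ⊆ {t : ℝ | t₀ ≤ (t : WithBot ℝ)},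
    (X.S m ω ∩ C).encard = {z | z ∈ π m ω ∧ z.1 ∈ C ∧ z.2 ≤ X.lam m z.1 ω}.encard
  eq_W : ∀ᵐ ω ∂Pr, ∀ q : P × ℤ, t₀ ≤ (G.time q : WithBot ℝ) →
    X.InputConverges G M t₀ (Sum.inr q.1) (G.time q) ω ∧
    X.W q ω = ξ q ω + M.Φ (Sum.inr q.1) (X.input G M t₀ (Sum.inr q.1) (G.time q) ω)

/-- Almost surely, finitely many points in every bounded set (the intensities and the chains are
real valued). -/
def Triple.NonExploding [MeasurableSpace Ω] (X : Triple Ω N P) (Pr : Measure Ω) : Prop :=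
  ∀ᵐ ω ∂Pr, ∀ m, ∀ C : Set ℝ, Bornology.IsBounded C → (X.S m ω ∩ C).Finite

/-- The intensities and the chains are bounded in `L¹`. -/
def Triple.BoundedL1 [MeasurableSpace Ω] (X : Triple Ω N P) (Pr : Measure Ω) : Prop :=
  (⨆ m, ⨆ t, ∫⁻ ω, ‖X.lam m t ω‖ₑ ∂Pr < ∞) ∧ ⨆ q, ∫⁻ ω, ‖X.W q ω‖ₑ ∂Pr < ∞

end Triples

/-! ### Recursion coefficients, cluster functions and immigrant rates -/

section Cluster

variable {N P : Type*} [Fintype P]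

open Classical in
/-- The coefficient `C^{p,k}_{p',k'}`, with `q = (p, k)` and `q' = (p', k')`: it is
`1_{p = p'}` if `k = k'`, it solves
`C^{p,k}_{p',k'} = ∑_{p''} ∫_{[k',k)} a^p_{p''} h^p_{p''} (k - k'') C^{p'',k''}_{p',k'} dμ_{p''}(k'')`
if `k' < k`, and it is set to `0` (and not used) if `k < k'`. -/
noncomputable def coef (G : Grid P) (M : Params N P) (q q' : P × ℤ) : ℝ :=
  if q = q' then 1
  else if G.time q' < G.time q then
    ∑ r ∈ (G.finite_Ico (G.time q') (G.time q)).toFinset.attach,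
      M.a (Sum.inr q.1) r.1.1 * M.h (Sum.inr q.1) (Sum.inr r.1.1) (G.time q - G.time r.1) *
        coef G M r.1 q'
  else 0
termination_by (G.finite_Ico (G.time q') (G.time q)).toFinset.card
decreasing_by
  have hr := (Set.Finite.mem_toFinset _).1 r.2
  apply Finset.card_lt_card
  rw [Finset.ssubset_iff_of_subset]
  · exact ⟨r.1, r.2, fun h => lt_irrefl _ ((Set.Finite.mem_toFinset _).1 h).2⟩
  · intro x hx
    have hx' := (Set.Finite.mem_toFinset _).1 hx
    exact (Set.Finite.mem_toFinset _).2 ⟨hx'.1, hx'.2.trans hr.2⟩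

/-- `ℍ^b_{p,k}(t₀)`. Its terms are nonnegative for linear parameters, and so are those of the
quantities below: all of them take values in `[0, ∞]`. -/
noncomputable def Hb (G : Grid P) (M : Params N P) (t₀ : WithBot ℝ) (q : P × ℤ) : ℝ≥0∞ :=
  ∑' q' : G.pastClosed t₀ (G.time q), ENNReal.ofReal (coef G M q q') *
    ∑' q'' : G.past t₀ (G.time q'),
      ENNReal.ofReal (M.b (Sum.inr q'.1.1) q''.1.1 *
        M.h (Sum.inr q'.1.1) (Sum.inr q''.1.1) (G.time q' - G.time q''))

/-- `ℍ^ξ_{p,k}(t₀)`, for a realization `x` of the random drifts. -/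
noncomputable def Hxi (G : Grid P) (M : Params N P) (t₀ : WithBot ℝ) (x : P × ℤ → ℝ)
    (q : P × ℤ) : ℝ≥0∞ :=
  ∑' q' : G.pastClosed t₀ (G.time q), ENNReal.ofReal (coef G M q q') * ENNReal.ofReal (x q')

open Classical in
/-- `ℍ^m_{p,k}(t₀, t)`. -/
noncomputable def Hpt (G : Grid P) (M : Params N P) (t₀ : WithBot ℝ) (m : N) (q : P × ℤ)
    (t : ℝ) : ℝ≥0∞ :=
  ∑' q' : G.pastClosed t₀ (G.time q), ENNReal.ofReal (coef G M q q') *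
    if t < G.time q' then
      ENNReal.ofReal (M.h (Sum.inr q'.1.1) (Sum.inl m) (G.time q' - t))
    else 0

/-- The cluster function `𝔥^m_{m₀}(s, t)`, for `s < t`: `q = (p, k)` runs over `s < k < t` and
`q' = (p', k')` over `s < k' ≤ k`. -/
noncomputable def clusterFun (G : Grid P) (M : Params N P) (m m₀ : N) (s t : ℝ) : ℝ≥0∞ :=
  ENNReal.ofReal (M.h (Sum.inl m) (Sum.inl m₀) (t - s)) +
    ∑' q : {q : P × ℤ // s < G.time q ∧ G.time q < t},
      ∑' q' : {q' : P × ℤ // s < G.time q' ∧ G.time q' ≤ G.time q},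
        ENNReal.ofReal (M.a (Sum.inl m) q.1.1 *
          M.h (Sum.inl m) (Sum.inr q.1.1) (t - G.time q)) *
        ENNReal.ofReal (coef G M q q') *
        ENNReal.ofReal (M.h (Sum.inr q'.1.1) (Sum.inl m₀) (G.time q' - s))

/-- The immigrant rate `ℐ^m(t₀, t)`, for a realization `x` of the random drifts. -/
noncomputable def immigrantRate (G : Grid P) (M : Params N P) (t₀ : WithBot ℝ)
    (x : P × ℤ → ℝ) (m : N) (t : ℝ) : ℝ≥0∞ :=
  ENNReal.ofReal (M.μ m) +
    ∑' q : G.past t₀ t,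
      ENNReal.ofReal (M.h (Sum.inl m) (Sum.inr q.1.1) (t - G.time q)) *
        (ENNReal.ofReal (M.a (Sum.inl m) q.1.1) * Hb G M t₀ q +
          ENNReal.ofReal (M.a (Sum.inl m) q.1.1) * Hxi G M t₀ x q +
          ENNReal.ofReal (M.b (Sum.inl m) q.1.1))

end Cluster

end HAR

/-!
Write the linear equation of the chains as `w = g + K w`, where `K` is the nonnegative kernel with
entries `a^p_{p'} h^p_{p'}(k - k')` and `g` collects the offsets of the masks, the drifts and the
points of the nodes. The recursion coefficients are the entries of the Neumann series `∑ Kⁿ`, so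
the representation of the chains says that `w = ∑ Kⁿ g`. The Neumann series is the least
nonnegative solution, and the difference `d` between `w` and it satisfies `d ≤ K d`, hence
`d ≤ Kⁿ d` for all `n`, so it vanishes as soon as `∑ Kⁿ w` is finite. For finite `t₀` that holds by
causality, as only finitely many grid times are involved; for `t₀ = -∞` it holds almost surely,
because `𝔼 ∑ Kⁿ w` is at most `(1 - H^W_W)⁻¹` applied to the bound on the means of the chains. The
same argument, applied to the negative parts of the chains, shows that these are nonnegative.

Inserting the representation of the chains in the equation of the intensities and exchanging the
sums gives the cluster representation. As the kernel is invariant under integer translations of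
time, the sum over `k ∈ 𝒟_p` of the influence of a point on the chain `p` reduces to `n_p` sums over
integer translates, each again dominated by `(1 - H^W_W)⁻¹`; this gives the `L¹` bound.
-/

namespace HAR

section Kernel

variable {ι κ : Type*} {K : ι → ι → ℝ≥0∞}

/-- The action `v ↦ K v` of a kernel `K` with values in `[0, ∞]` on functions with values in
`[0, ∞]`. -/
noncomputable def kernelOp (K : ι → ι → ℝ≥0∞) : (ι → ℝ≥0∞) →+ (ι → ℝ≥0∞) where
  toFun v q := ∑' r, K q r * v r
  map_zero' := by ext; simp
  map_add' u v := by ext; simp only [Pi.add_apply, mul_add, ENNReal.tsum_add]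

theorem kernelOp_apply (K : ι → ι → ℝ≥0∞) (v : ι → ℝ≥0∞) (q : ι) :
    kernelOp K v q = ∑' r, K q r * v r :=
  rfl

theorem kernelOp_mono (K : ι → ι → ℝ≥0∞) : Monotone (kernelOp K) := fun _ _ h _ =>
  ENNReal.tsum_le_tsum fun r => mul_le_mul_right (h r) _

/-- The Neumann series `∑_n K^n g`, the least solution `w` of `w = g + K w`. -/
noncomputable def potential (K : ι → ι → ℝ≥0∞) (g : ι → ℝ≥0∞) : ι → ℝ≥0∞ := fun q =>
  ∑' n, (kernelOp K)^[n] g q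

theorem potential_eq_add_kernelOp (K : ι → ι → ℝ≥0∞) (g : ι → ℝ≥0∞) :
    potential K g = g + kernelOp K (potential K g) := by
  ext q
  calc potential K g q = g q + ∑' n, ∑' r, K q r * (kernelOp K)^[n] g r := by
        rw [potential, tsum_eq_zero_add' ENNReal.summable]
        simp only [Function.iterate_succ_apply', kernelOp_apply, Function.iterate_zero_apply]
    _ = _ := by
        rw [ENNReal.tsum_comm]
        simp only [ENNReal.tsum_mul_left, Pi.add_apply, kernelOp_apply, potential]

theorem potential_le {g w : ι → ℝ≥0∞} (h : g + kernelOp K w ≤ w) : potential K g ≤ w := by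
  have partial_sum_le (n : ℕ) : ∑ i ∈ Finset.range n, (kernelOp K)^[i] g ≤ w := by
    induction n with
    | zero => exact zero_le
    | succ n ih =>
      calc ∑ i ∈ Finset.range (n + 1), (kernelOp K)^[i] g
          = g + kernelOp K (∑ i ∈ Finset.range n, (kernelOp K)^[i] g) := by
            rw [Finset.sum_range_succ', map_sum, add_comm]
            simp only [Function.iterate_succ_apply', Function.iterate_zero_apply]
        _ ≤ g + kernelOp K w := by gcongr; exact kernelOp_mono K ih
        _ ≤ w := h
  refine fun q => ENNReal.tsum_le_of_sum_range_le fun n => ?_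
  simpa only [Finset.sum_apply] using partial_sum_le n q

theorem potential_mono (K : ι → ι → ℝ≥0∞) : Monotone (potential K) := fun _ g' h =>
  potential_le <| (add_le_add_left h _).trans (potential_eq_add_kernelOp K g').ge

theorem potential_eq_zero_of_mem {s : Set ι} (hK : ∀ q ∈ s, ∀ r ∉ s, K q r = 0) {g : ι → ℝ≥0∞}
    (hg : ∀ q ∈ s, g q = 0) {q : ι} (hq : q ∈ s) : potential K g q = 0 := by
  have h : g + kernelOp K (sᶜ.indicator ⊤) ≤ sᶜ.indicator ⊤ := by
    intro q
    by_cases hq : q ∈ s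
    · have hz : ∀ r, K q r * sᶜ.indicator ⊤ r = 0 := fun r => by
        by_cases hr : r ∈ s
        · simp [hr]
        · simp [hK q hq r hr]
      simp [kernelOp_apply, hg q hq, hz]
    · simp [hq]
  simpa [hq] using potential_le h q

theorem iterate_kernelOp_eq_tsum_single [DecidableEq ι] (K : ι → ι → ℝ≥0∞) (g : ι → ℝ≥0∞)
    (n : ℕ) (q : ι) :
    (kernelOp K)^[n] g q = ∑' r, (kernelOp K)^[n] (Pi.single r 1) q * g r := by
  induction n generalizing q with
  | zero =>
    simp only [Function.iterate_zero_apply]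
    rw [tsum_eq_single q fun r hr => by simp [hr.symm], Pi.single_eq_same, one_mul]
  | succ n ih =>
    simp only [Function.iterate_succ_apply', kernelOp_apply]
    simp only [ih, ← ENNReal.tsum_mul_left, ← ENNReal.tsum_mul_right, mul_assoc]
    exact ENNReal.tsum_comm

theorem potential_eq_tsum_single [DecidableEq ι] (K : ι → ι → ℝ≥0∞) (g : ι → ℝ≥0∞) (q : ι) :
    potential K g q = ∑' r, potential K (Pi.single r 1) q * g r := by
  simp only [potential, ← ENNReal.tsum_mul_right]
  rw [ENNReal.tsum_comm]
  exact tsum_congr fun n => iterate_kernelOp_eq_tsum_single K g n q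

theorem potential_tsum (K : ι → ι → ℝ≥0∞) {σ : Type*} (g : σ → ι → ℝ≥0∞) (q : ι) :
    potential K (fun r => ∑' i, g i r) q = ∑' i, potential K (g i) q := by
  classical
  rw [potential_eq_tsum_single]
  simp only [← ENNReal.tsum_mul_left]
  rw [ENNReal.tsum_comm]
  exact tsum_congr fun i => (potential_eq_tsum_single K (g i) q).symm

theorem potential_add (K : ι → ι → ℝ≥0∞) (g g' : ι → ℝ≥0∞) :
    potential K (g + g') = potential K g + potential K g' := by
  ext q
  simp only [potential, iterate_map_add, Pi.add_apply, ENNReal.tsum_add]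

theorem potential_comp_equiv (e : ι ≃ ι) (he : ∀ q r, K (e q) (e r) = K q r) (g : ι → ℝ≥0∞) :
    potential K (g ∘ e) = potential K g ∘ e := by
  have h : Function.Semiconj (fun v : ι → ℝ≥0∞ => v ∘ e) (kernelOp K) (kernelOp K) := fun v => by
    ext q
    simp only [Function.comp_apply, kernelOp_apply, ← e.tsum_eq (fun r => K (e q) r * v r), he]
  ext q
  exact tsum_congr fun n => (congrFun ((h.iterate_right n).eq g) q).symm

theorem potential_comp_le {A : κ → κ → ℝ≥0∞} {f : ι → κ}
    (h : ∀ u : κ → ℝ≥0∞, kernelOp K (u ∘ f) ≤ kernelOp A u ∘ f) (u : κ → ℝ≥0∞) :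
    potential K (u ∘ f) ≤ potential A u ∘ f :=
  potential_le <| (add_le_add_right (h _) _).trans fun q =>
    (congrFun (potential_eq_add_kernelOp A u) (f q)).ge

/-- Iterating `d ≤ K d` bounds `d` by every term `K^n d` of a convergent series. -/
theorem eq_zero_of_le_kernelOp {d : ι → ℝ≥0∞} (h : d ≤ kernelOp K d)
    (hd : ∀ q, potential K d q ≠ ∞) : d = 0 := by
  have le_iterate (n : ℕ) : d ≤ (kernelOp K)^[n] d :=
    ((kernelOp_mono K).monotone_iterate_of_le_map h) (Nat.zero_le n)
  ext q
  exact nonpos_iff_eq_zero.1 <| ge_of_tendsto'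
    (ENNReal.tendsto_atTop_zero_of_tsum_ne_top (hd q)) fun n => le_iterate n q

theorem eq_potential {g w : ι → ℝ≥0∞} (h : w = g + kernelOp K w)
    (hw : ∀ q, potential K w q ≠ ∞) : w = potential K g := by
  have w_eq : w = potential K g + (w - potential K g) :=
    (add_tsub_cancel_of_le (potential_le h.ge)).symm
  have hd : w - potential K g ≤ kernelOp K (w - potential K g) := by
    refine tsub_le_iff_left.2 (le_of_eq ?_)
    conv_lhs => rw [h, w_eq, map_add, ← add_assoc, ← potential_eq_add_kernelOp]
  rw [w_eq, eq_zero_of_le_kernelOp hd fun q => ne_top_of_le_ne_top (hw q)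
    (potential_mono K tsub_le_self q), add_zero]

section Measure

variable {Ω : Type*} [MeasurableSpace Ω] {Pr : Measure Ω} [Countable ι]

theorem lintegral_potential {v : ι → Ω → ℝ≥0∞} (hv : ∀ r, AEMeasurable (v r) Pr) (q : ι) :
    ∫⁻ ω, potential K (fun r => v r ω) q ∂Pr = potential K (fun r => ∫⁻ ω, v r ω ∂Pr) q := by
  classical
  rw [lintegral_congr fun ω => potential_eq_tsum_single K (fun r => v r ω) q,
    lintegral_tsum fun r => (hv r).const_mul _, potential_eq_tsum_single]
  exact tsum_congr fun r => lintegral_const_mul'' _ (hv r)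

theorem ae_potential_ne_top {v : ι → Ω → ℝ≥0∞} (hv : ∀ r, AEMeasurable (v r) Pr)
    (h : ∀ q, potential K (fun r => ∫⁻ ω, v r ω ∂Pr) q ≠ ∞) :
    ∀ᵐ ω ∂Pr, ∀ q, potential K (fun r => v r ω) q ≠ ∞ := by
  classical
  refine ae_all_iff.2 fun q => (ae_lt_top' ?_ ?_).mono fun _ => ne_of_lt
  · rw [funext fun ω => potential_eq_tsum_single K (fun r => v r ω) q]
    exact AEMeasurable.tsum fun r => (hv r).const_mul _
  · rw [lintegral_potential hv]; exact h q

end Measure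

end Kernel

section SpectralRadius

open Filter Topology

theorem tendsto_pow_of_spectralRadius_lt_one {A : Type*} [NormedRing A] [NormedAlgebra ℂ A]
    [CompleteSpace A] {a : A} (h : spectralRadius ℂ a < 1) :
    Tendsto (fun n : ℕ => a ^ n) atTop (𝓝 0) := by
  obtain ⟨r, hr, hr1⟩ := ENNReal.lt_iff_exists_nnreal_btwn.1 h
  have nnnorm_pow_le : ∀ᶠ n : ℕ in atTop, ‖a ^ n‖ ≤ (r : ℝ) ^ n := by
    filter_upwards [(spectrum.pow_nnnorm_pow_one_div_tendsto_nhds_spectralRadius a).eventually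
      (gt_mem_nhds hr), eventually_gt_atTop 0] with n hn hn0
    have h := (ENNReal.rpow_inv_le_iff (by positivity : (0 : ℝ) < n)).1 (one_div (n : ℝ) ▸ hn.le)
    rw [ENNReal.rpow_natCast] at h
    exact_mod_cast h
  exact squeeze_zero_norm' nnnorm_pow_le
    (tendsto_pow_atTop_nhds_zero_of_lt_one r.coe_nonneg (by exact_mod_cast hr1))

attribute [local instance] Matrix.linftyOpNormedRing Matrix.linftyOpNormedAlgebra

variable {ι κ : Type*} [Fintype ι] [DecidableEq ι] [Fintype κ] [DecidableEq κ]

theorem map_ofReal_pow (A : Matrix ι ι ℝ) (n : ℕ) :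
    (A.map (fun x : ℝ => (x : ℂ))) ^ n = (A ^ n).map (fun x : ℝ => (x : ℂ)) :=
  (map_pow (Complex.ofRealHom.mapMatrix (m := ι)) A n).symm

theorem tendsto_pow_apply_of_spectralRadius_lt_one {A : Matrix ι ι ℝ}
    (h : spectralRadius ℂ (A.map (fun x : ℝ => (x : ℂ))) < 1) (i j : ι) :
    Tendsto (fun n : ℕ => (A ^ n) i j) atTop (𝓝 0) := by
  have h_complex := tendsto_pow_of_spectralRadius_lt_one h
  simp only [map_ofReal_pow] at h_complex
  exact (Complex.continuous_re.tendsto 0).comp (tendsto_pi_nhds.1 (tendsto_pi_nhds.1 h_complex i) j)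

theorem isUnit_det_one_sub_of_spectralRadius_lt_one {A : Matrix ι ι ℝ}
    (h : spectralRadius ℂ (A.map (fun x : ℝ => (x : ℂ))) < 1) : IsUnit (1 - A).det := by
  have h_unit := spectrum.mem_resolventSet_of_spectralRadius_lt (k := (1 : ℂ)) (by simpa using h)
  have h_map : 1 - A.map (fun x : ℝ => (x : ℂ)) = Complex.ofRealHom.mapMatrix (1 - A) := by
    rw [map_sub, map_one]; rfl
  rw [spectrum.mem_resolventSet_iff, map_one, Matrix.isUnit_iff_isUnit_det, h_map,
    ← RingHom.map_det] at h_unit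
  exact (isUnit_map_iff Complex.ofRealHom _).1 h_unit

theorem inv_one_sub_eq_one_add_mul {A : Matrix ι ι ℝ} (h : IsUnit (1 - A).det) :
    (1 - A)⁻¹ = 1 + A * (1 - A)⁻¹ := by
  have h_mul := Matrix.mul_nonsing_inv _ h
  rw [sub_mul, one_mul] at h_mul
  exact sub_eq_iff_eq_add.1 h_mul

theorem pow_apply_nonneg {A : Matrix ι ι ℝ} (hA : ∀ i j, 0 ≤ A i j) (n : ℕ) (i j : ι) :
    0 ≤ (A ^ n) i j := by
  induction n generalizing i j with
  | zero => rw [pow_zero, Matrix.one_apply]; split_ifs <;> norm_num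
  | succ n ih =>
    rw [pow_succ, Matrix.mul_apply]
    exact Finset.sum_nonneg fun k _ => mul_nonneg (ih i k) (hA k j)

theorem inv_one_sub_apply_nonneg {A : Matrix ι ι ℝ} (hA : ∀ i j, 0 ≤ A i j)
    (h : spectralRadius ℂ (A.map (fun x : ℝ => (x : ℂ))) < 1) (i j : ι) :
    0 ≤ (1 - A)⁻¹ i j := by
  set B := (1 - A)⁻¹
  have B_eq : B = 1 + A * B :=
    inv_one_sub_eq_one_add_mul (isUnit_det_one_sub_of_spectralRadius_lt_one h)
  have pow_mul_le (n : ℕ) : (A ^ n * B) i j ≤ B i j := by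
    induction n with
    | zero => simp
    | succ n ih =>
      have : A ^ n * B = A ^ n + A ^ (n + 1) * B := by
        conv_lhs => rw [B_eq, mul_add, mul_one, ← mul_assoc, ← pow_succ]
      rw [this, Matrix.add_apply] at ih
      linarith [pow_apply_nonneg hA n i j]
  have h_lim : Tendsto (fun n : ℕ => (A ^ n * B) i j) atTop (𝓝 (∑ k, 0 * B k j)) := by
    simp only [Matrix.mul_apply]
    exact tendsto_finsetSum _ fun k _ =>
      (tendsto_pow_apply_of_spectralRadius_lt_one h i k).mul_const _
  simpa using le_of_tendsto' h_lim pow_mul_le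

theorem potential_ofReal_le {A : Matrix ι ι ℝ} (hA : ∀ i j, 0 ≤ A i j)
    (h : spectralRadius ℂ (A.map (fun x : ℝ => (x : ℂ))) < 1) (u : ι → ℝ≥0∞) (i : ι) :
    potential (fun i j => ENNReal.ofReal (A i j)) u i ≤
      ∑ j, ENNReal.ofReal ((1 - A)⁻¹ i j) * u j := by
  set B := (1 - A)⁻¹ with hB
  have hB0 : ∀ i j, 0 ≤ B i j := inv_one_sub_apply_nonneg hA h
  have ofReal_B (i j : ι) : ENNReal.ofReal (B i j) = ENNReal.ofReal ((1 : Matrix ι ι ℝ) i j) +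
      ∑ k, ENNReal.ofReal (A i k) * ENNReal.ofReal (B k j) := by
    conv_lhs => rw [hB, inv_one_sub_eq_one_add_mul
      (isUnit_det_one_sub_of_spectralRadius_lt_one h), ← hB, Matrix.add_apply, Matrix.mul_apply]
    have one_nonneg : 0 ≤ (1 : Matrix ι ι ℝ) i j := by
      simpa using pow_apply_nonneg hA 0 i j
    rw [ENNReal.ofReal_add one_nonneg (Finset.sum_nonneg fun k _ => mul_nonneg (hA i k) (hB0 k j)),
      ENNReal.ofReal_sum_of_nonneg fun k _ => mul_nonneg (hA i k) (hB0 k j)]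
    simp only [ENNReal.ofReal_mul (hA i _)]
  refine potential_le (w := fun i => ∑ j, ENNReal.ofReal (B i j) * u j) (fun i => ?_) i
  refine le_of_eq ?_
  simp only [Pi.add_apply, kernelOp_apply, tsum_fintype (L := .unconditional ι), ofReal_B i,
    add_mul, Finset.sum_add_distrib, Finset.sum_mul, Finset.mul_sum, mul_assoc]
  rw [Finset.sum_comm]
  simp [Matrix.one_apply, apply_ite ENNReal.ofReal]

theorem toBlocks₂₂_pow_apply_le {A : Matrix (κ ⊕ ι) (κ ⊕ ι) ℝ} (hA : ∀ i j, 0 ≤ A i j)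
    (n : ℕ) (i j : ι) : (A.toBlocks₂₂ ^ n) i j ≤ (A ^ n) (Sum.inr i) (Sum.inr j) := by
  induction n generalizing i j with
  | zero => simp [Matrix.one_apply]
  | succ n ih =>
    rw [pow_succ, pow_succ, Matrix.mul_apply, Matrix.mul_apply, Fintype.sum_sum_type]
    refine le_add_of_nonneg_of_le
      (Finset.sum_nonneg fun k _ => mul_nonneg (pow_apply_nonneg hA _ _ _) (hA _ _)) ?_
    exact Finset.sum_le_sum fun k _ => mul_le_mul_of_nonneg_right (ih i k) (hA _ _)

theorem nnnorm_toBlocks₂₂_pow_le {A : Matrix (κ ⊕ ι) (κ ⊕ ι) ℝ} (hA : ∀ i j, 0 ≤ A i j) (n : ℕ) :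
    ‖(A.toBlocks₂₂.map (fun x : ℝ => (x : ℂ))) ^ n‖₊ ≤ ‖(A.map (fun x : ℝ => (x : ℂ))) ^ n‖₊ := by
  have hA₂₂ : ∀ i j, 0 ≤ A.toBlocks₂₂ i j := fun _ _ => hA _ _
  rw [map_ofReal_pow, map_ofReal_pow, Matrix.linfty_opNNNorm_def, Matrix.linfty_opNNNorm_def]
  refine Finset.sup_le fun i _ => le_trans ?_ (Finset.le_sup (Finset.mem_univ (Sum.inr i)))
  rw [Fintype.sum_sum_type]
  refine le_add_of_nonneg_of_le zero_le (Finset.sum_le_sum fun j _ => ?_)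
  rw [← NNReal.coe_le_coe, coe_nnnorm, coe_nnnorm, Matrix.map_apply, Matrix.map_apply,
    Complex.norm_real, Complex.norm_real, Real.norm_of_nonneg (pow_apply_nonneg hA n _ _),
    Real.norm_of_nonneg (pow_apply_nonneg hA₂₂ n i j)]
  exact toBlocks₂₂_pow_apply_le hA n i j

theorem spectralRadius_toBlocks₂₂_le {A : Matrix (κ ⊕ ι) (κ ⊕ ι) ℝ} (hA : ∀ i j, 0 ≤ A i j) :
    spectralRadius ℂ (A.toBlocks₂₂.map (fun x : ℝ => (x : ℂ))) ≤
      spectralRadius ℂ (A.map (fun x : ℝ => (x : ℂ))) :=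
  le_of_tendsto_of_tendsto'
    (spectrum.pow_nnnorm_pow_one_div_tendsto_nhds_spectralRadius _)
    (spectrum.pow_nnnorm_pow_one_div_tendsto_nhds_spectralRadius _) fun n =>
      ENNReal.rpow_le_rpow (by exact_mod_cast nnnorm_toBlocks₂₂_pow_le hA n) (by positivity)

end SpectralRadius

section Params

/-- `u ↦ |f u|` on `(0, ∞)`, extended by `0`: with this extension, a restriction such as `s < t`
in a sum of terms `f (t - s)` need not be written. -/
noncomputable def causal (f : ℝ → ℝ) : ℝ → ℝ≥0∞ := (Ioi 0).indicator fun u => ‖f u‖ₑ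

theorem causal_of_pos {u : ℝ} (hu : 0 < u) (f : ℝ → ℝ) : causal f u = ‖f u‖ₑ :=
  indicator_of_mem (s := Ioi 0) hu _

theorem causal_of_nonpos {u : ℝ} (hu : u ≤ 0) (f : ℝ → ℝ) : causal f u = 0 :=
  indicator_of_notMem (s := Ioi 0) hu.not_gt _

theorem causal_ne_top (f : ℝ → ℝ) (u : ℝ) : causal f u ≠ ∞ := by
  rcases lt_or_ge 0 u with hu | hu
  · exact causal_of_pos hu f ▸ enorm_ne_top
  · exact causal_of_nonpos hu f ▸ ENNReal.zero_ne_top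

theorem measurable_causal {f : ℝ → ℝ} (hf : Measurable f) : Measurable (causal f) :=
  hf.enorm.indicator measurableSet_Ioi

theorem lintegral_causal_sub (f : ℝ → ℝ) (s : ℝ) : ∫⁻ t, causal f (t - s) = normL1 f := by
  rw [lintegral_sub_right_eq_self, causal, lintegral_indicator measurableSet_Ioi, normL1]

theorem tsum_causal_le_normLattice (f : ℝ → ℝ) (n : ℕ) (x : ℝ) :
    ∑' k : ℤ, causal f (x + k / n) ≤ normLattice f n := by
  classical
  refine le_iSup_of_le x (le_of_eq (tsum_congr fun k => ?_))
  simp only [causal, indicator_apply, mem_Ioi]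

theorem lip_eq_of_forall {f : ℝ → ℝ} {a b : ℝ} (ha : 0 ≤ a) (hf : ∀ x, f x = a * x + b) :
    (lip f : ℝ) = a := by
  lift a to ℝ≥0 using ha
  have dist_eq (x y : ℝ) : dist (f x) (f y) = a * dist x y := by
    rw [hf, hf, Real.dist_eq, Real.dist_eq, add_sub_add_right_eq_sub, ← mul_sub, abs_mul,
      NNReal.abs_eq]
  have isLeast : IsLeast {K : ℝ≥0 | LipschitzWith K f} a :=
    ⟨.of_dist_le_mul fun x y => (dist_eq x y).le, fun K hK => by
      simpa [dist_eq] using LipschitzWith.dist_le_mul hK 1 0⟩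
  rw [lip, isLeast.csInf_eq]

namespace Params

variable {N P : Type*} {M : Params N P}

theorem a_nonneg (M : Params N P) (α : N ⊕ P) (p : P) : 0 ≤ M.a α p := NNReal.coe_nonneg _

theorem IsLinear.mask_eq (hM : M.IsLinear) (α : N ⊕ P) (p : P) (x : ℝ) :
    M.κ α p x = M.a α p * x + M.b α p := by
  obtain ⟨a, b, ha, -, h⟩ := hM.mask α p
  rw [Params.a, lip_eq_of_forall ha h, Params.b, h, h, mul_zero, zero_add]

theorem IsLinear.b_nonneg (hM : M.IsLinear) (α : N ⊕ P) (p : P) : 0 ≤ M.b α p := by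
  obtain ⟨a, b, -, hb, h⟩ := hM.mask α p
  rwa [Params.b, h, mul_zero, zero_add]

theorem IsLinear.ofReal_h (hM : M.IsLinear) (α β : N ⊕ P) {u : ℝ} (hu : 0 < u) :
    ENNReal.ofReal (M.h α β u) = causal (M.h α β) u := by
  rw [causal_of_pos hu, Real.enorm_of_nonneg (hM.h_nonneg α β u hu)]

theorem IsLinear.lip_link_chain (hM : M.IsLinear) (p : P) : (lip (M.Φ (Sum.inr p)) : ℝ) = 1 :=
  lip_eq_of_forall zero_le_one (b := 0) fun x => by rw [hM.link_chain, id, one_mul, add_zero]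

theorem H_nonneg (M : Params N P) (G : Grid P) (α β : N ⊕ P) : 0 ≤ M.H G α β := by
  cases β with
  | inl m => exact mul_nonneg (NNReal.coe_nonneg _) ENNReal.toReal_nonneg
  | inr p =>
    exact mul_nonneg (mul_nonneg (NNReal.coe_nonneg _) (M.a_nonneg _ _)) ENNReal.toReal_nonneg

theorem HWW_nonneg (M : Params N P) (G : Grid P) (p p' : P) : 0 ≤ M.HWW G p p' :=
  M.H_nonneg G (Sum.inr p) (Sum.inr p')

theorem Spec1.spec11 [Fintype N] [Fintype P] [DecidableEq N] [DecidableEq P] {G : Grid P}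
    (h : M.Spec1 G) : M.Spec11 G :=
  ⟨fun _ _ => h.1 _ _, (spectralRadius_toBlocks₂₂_le (M.H_nonneg G)).trans_lt h.2⟩

theorem IsLinear.ofReal_HWW (hM : M.IsLinear) {G : Grid P} {p p' : P}
    (h : M.hNorm G (Sum.inr p) (Sum.inr p') ≠ ∞) :
    ENNReal.ofReal (M.HWW G p p') = ENNReal.ofReal (M.a (Sum.inr p) p') *
      normLattice (M.h (Sum.inr p) (Sum.inr p')) (G.n p') := by
  have HWW_eq : M.HWW G p p' = lip (M.Φ (Sum.inr p)) * M.a (Sum.inr p) p' *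
    (M.hNorm G (Sum.inr p) (Sum.inr p')).toReal := rfl
  rw [HWW_eq, hM.lip_link_chain, one_mul, ENNReal.ofReal_mul (M.a_nonneg _ _),
    ENNReal.ofReal_toReal h, hNorm]

end Params

end Params

namespace Grid

variable {P : Type*}

/-- The elements `(p, k)` of `𝒬` with `k ≥ t₀`. -/
def since (G : Grid P) (t₀ : WithBot ℝ) : Set (P × ℤ) := {q | t₀ ≤ (G.time q : WithBot ℝ)}

/-- The translation `(p, k) ↦ (p, k + l)` of `𝒬` by an integer time `l`. -/
def shift (G : Grid P) (l : ℤ) : P × ℤ ≃ P × ℤ :=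
  Equiv.prodShear (Equiv.refl P) fun p => Equiv.addRight (l * G.n p)

theorem time_shift (G : Grid P) (l : ℤ) (q : P × ℤ) : G.time (G.shift l q) = G.time q + l := by
  have : (G.n q.1 : ℝ) ≠ 0 := by exact_mod_cast (G.n_pos q.1).ne'
  simp only [time, shift, Equiv.prodShear_apply, Equiv.refl_apply, Equiv.coe_addRight]
  push_cast
  field_simp
  ring

/-- Well-founded because only finitely many grid times lie between `t₁` and a given one. -/
theorem induction [Finite P] (G : Grid P) (t₁ : ℝ) {motive : P × ℤ → Prop}
    (h : ∀ q, (∀ r, t₁ ≤ G.time r → G.time r < G.time q → motive r) → motive q) (q : P × ℤ) :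
    motive q := by
  induction hn : (G.finite_Ico t₁ (G.time q)).toFinset.card using Nat.strong_induction_on
    generalizing q with
  | _ n ih =>
    refine h q fun r h1 h2 => ih _ ?_ r rfl
    rw [← hn]
    refine Finset.card_lt_card ((Finset.ssubset_iff_of_subset ?_).2 ⟨r, ?_, ?_⟩)
    · exact Set.Finite.toFinset_subset_toFinset.2 fun x hx => ⟨hx.1, hx.2.trans h2⟩
    · exact (Set.Finite.mem_toFinset _).2 ⟨h1, h2⟩
    · exact fun hr => lt_irrefl _ ((Set.Finite.mem_toFinset _).1 hr).2

theorem tsum_past_causal_mul (G : Grid P) (t₀ : WithBot ℝ) (t : ℝ) (f : P → ℝ → ℝ)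
    (w : P × ℤ → ℝ≥0∞) :
    ∑' q : G.past t₀ t, causal (f q.1.1) (t - G.time q) * w q =
      ∑' q, causal (f q.1) (t - G.time q) * (G.since t₀).indicator w q := by
  rw [tsum_subtype (G.past t₀ t) fun q => causal (f q.1) (t - G.time q) * w q]
  refine tsum_congr fun q => ?_
  by_cases h₀ : q ∈ G.since t₀
  · rcases lt_or_ge (G.time q) t with h | h
    · rw [indicator_of_mem (show q ∈ G.past t₀ t from ⟨h₀, h⟩), indicator_of_mem h₀]
    · rw [indicator_of_notMem fun hq : q ∈ G.past t₀ t => hq.2.not_ge h,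
        causal_of_nonpos (sub_nonpos.2 h), zero_mul]
  · rw [indicator_of_notMem fun hq : q ∈ G.past t₀ t => h₀ hq.1, indicator_of_notMem h₀, mul_zero]

end Grid

section ChainKernel

variable {N P : Type*} {G : Grid P} {M : Params N P}

/-- The weight `a^p_{p'} |h^p_{p'}(k - k')|` with which the value of the chains at
`r = (p', k')` enters linearly the one at `q = (p, k)`; it is `0` unless `k' < k`. -/
noncomputable def chainKernel (G : Grid P) (M : Params N P) (q r : P × ℤ) : ℝ≥0∞ :=
  ENNReal.ofReal (M.a (Sum.inr q.1) r.1) *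
    causal (M.h (Sum.inr q.1) (Sum.inr r.1)) (G.time q - G.time r)

theorem chainKernel_of_le {q r : P × ℤ} (h : G.time q ≤ G.time r) : chainKernel G M q r = 0 := by
  rw [chainKernel, causal_of_nonpos (sub_nonpos.2 h), mul_zero]

theorem chainKernel_ne_top (q r : P × ℤ) : chainKernel G M q r ≠ ∞ :=
  ENNReal.mul_ne_top ENNReal.ofReal_ne_top (causal_ne_top _ _)

theorem chainKernel_shift (l : ℤ) (q r : P × ℤ) :
    chainKernel G M (G.shift l q) (G.shift l r) = chainKernel G M q r := by
  rw [chainKernel, Grid.time_shift, Grid.time_shift, add_sub_add_right_eq_sub]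
  rfl

theorem potential_chainKernel_eq_zero {I : Set ℝ} (hI : IsLowerSet I) {g : P × ℤ → ℝ≥0∞}
    (hg : ∀ q, G.time q ∈ I → g q = 0) {q : P × ℤ} (hq : G.time q ∈ I) :
    potential (chainKernel G M) g q = 0 :=
  potential_eq_zero_of_mem (s := G.time ⁻¹' I)
    (fun _ hq _ hr => chainKernel_of_le (le_of_lt (lt_of_not_ge fun h => hr (hI h hq)))) hg hq

theorem potential_chainKernel_ne_top [Finite P] {w : P × ℤ → ℝ≥0∞} (hw : ∀ q, w q ≠ ∞) {t₁ : ℝ}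
    (h₀ : ∀ q, G.time q < t₁ → w q = 0) (q : P × ℤ) : potential (chainKernel G M) w q ≠ ∞ := by
  refine G.induction t₁ (motive := (potential (chainKernel G M) w · ≠ ∞)) (fun q ih => ?_) q
  have hfin := G.finite_Ico t₁ (G.time q)
  rw [potential_eq_add_kernelOp, Pi.add_apply, kernelOp_apply, tsum_eq_sum (s := hfin.toFinset)]
  · refine ENNReal.add_ne_top.2 ⟨hw q, ENNReal.sum_ne_top.2 fun r hr => ?_⟩
    have hr := hfin.mem_toFinset.1 hr
    exact ENNReal.mul_ne_top (chainKernel_ne_top q r) (ih r hr.1 hr.2)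
  · intro r hr
    rcases lt_or_ge (G.time r) t₁ with h | h
    · rw [potential_chainKernel_eq_zero (isLowerSet_Iio t₁) h₀ h, mul_zero]
    · rw [chainKernel_of_le (le_of_not_gt fun h' => hr (hfin.mem_toFinset.2 ⟨h, h'⟩)), zero_mul]

theorem tsum_chainKernel_le (q : P × ℤ) (p' : P) :
    ∑' j : ℤ, chainKernel G M q (p', j) ≤ ENNReal.ofReal (M.a (Sum.inr q.1) p') *
      normLattice (M.h (Sum.inr q.1) (Sum.inr p')) (G.n p') := by
  have time_sub (j : ℤ) :
      G.time q - G.time (p', -j) = G.time q - G.θ p' + (j : ℝ) / (G.n p' : ℝ) := by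
    simp only [Grid.time]; push_cast; ring
  simp only [chainKernel, ENNReal.tsum_mul_left]
  gcongr
  rw [← (Equiv.neg ℤ).tsum_eq]
  simp only [Equiv.neg_apply, time_sub]
  exact tsum_causal_le_normLattice _ _ _

section Coef

variable [Fintype P]

theorem coef_eq [DecidableEq P] (q q' : P × ℤ) :
    coef G M q q' = (Pi.single q' 1 : P × ℤ → ℝ) q +
      ∑ r ∈ (G.finite_Ico (G.time q') (G.time q)).toFinset,
        M.a (Sum.inr q.1) r.1 * M.h (Sum.inr q.1) (Sum.inr r.1) (G.time q - G.time r) *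
          coef G M r q' := by
  have h_empty (h : G.time q ≤ G.time q') :
      (G.finite_Ico (G.time q') (G.time q)).toFinset = ∅ := by
    rw [Set.Finite.toFinset_eq_empty]
    exact eq_empty_of_forall_notMem fun r hr => (hr.1.trans_lt hr.2).not_ge h
  rw [coef]
  split_ifs with hq hlt
  · subst hq
    rw [h_empty le_rfl, Finset.sum_empty, Pi.single_eq_same, add_zero]
  · rw [Pi.single_eq_of_ne hq, zero_add]
    exact Finset.sum_attach _ fun r => M.a (Sum.inr q.1) r.1 *
      M.h (Sum.inr q.1) (Sum.inr r.1) (G.time q - G.time r) * coef G M r q'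
  · rw [h_empty (not_lt.1 hlt), Finset.sum_empty, Pi.single_eq_of_ne hq, add_zero]

theorem coef_of_time_lt {q q' : P × ℤ} (h : G.time q < G.time q') : coef G M q q' = 0 := by
  rw [coef, if_neg (by rintro rfl; exact lt_irrefl _ h), if_neg h.not_gt]

theorem coef_nonneg (hM : M.IsLinear) (q q' : P × ℤ) : 0 ≤ coef G M q q' := by
  classical
  refine G.induction (G.time q') (motive := (0 ≤ coef G M · q')) (fun q ih => ?_) q
  rw [coef_eq]
  refine add_nonneg ((Pi.single_nonneg (α := fun _ : P × ℤ => ℝ)).2 zero_le_one q)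
    (Finset.sum_nonneg fun r hr => ?_)
  have hr := (Set.Finite.mem_toFinset _).1 hr
  exact mul_nonneg (mul_nonneg (M.a_nonneg _ _) (hM.h_nonneg _ _ _ (sub_pos.2 hr.2)))
    (ih r hr.1 hr.2)

theorem ofReal_coef_eq_add_kernelOp [DecidableEq P] (hM : M.IsLinear) (q' : P × ℤ) :
    (fun q => ENNReal.ofReal (coef G M q q')) = Pi.single q' 1 +
      kernelOp (chainKernel G M) fun q => ENNReal.ofReal (coef G M q q') := by
  ext q
  have hfin := G.finite_Ico (G.time q') (G.time q)
  have ofReal_term {r : P × ℤ} (hr : r ∈ hfin.toFinset) :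
      ENNReal.ofReal (M.a (Sum.inr q.1) r.1 *
        M.h (Sum.inr q.1) (Sum.inr r.1) (G.time q - G.time r) * coef G M r q') =
      chainKernel G M q r * ENNReal.ofReal (coef G M r q') := by
    rw [ENNReal.ofReal_mul' (coef_nonneg hM r q'), ENNReal.ofReal_mul (M.a_nonneg _ _),
      hM.ofReal_h _ _ (sub_pos.2 (hfin.mem_toFinset.1 hr).2), chainKernel]
  have term_nonneg {r : P × ℤ} (hr : r ∈ hfin.toFinset) :
      0 ≤ M.a (Sum.inr q.1) r.1 *
        M.h (Sum.inr q.1) (Sum.inr r.1) (G.time q - G.time r) * coef G M r q' :=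
    mul_nonneg (mul_nonneg (M.a_nonneg _ _)
      (hM.h_nonneg _ _ _ (sub_pos.2 (hfin.mem_toFinset.1 hr).2))) (coef_nonneg hM r q')
  rw [coef_eq, ENNReal.ofReal_add ((Pi.single_nonneg (α := fun _ : P × ℤ => ℝ)).2 zero_le_one q)
    (Finset.sum_nonneg fun r => term_nonneg), ENNReal.ofReal_sum_of_nonneg fun r => term_nonneg,
    Finset.sum_congr rfl fun r => ofReal_term, Pi.add_apply, kernelOp_apply,
    tsum_eq_sum (s := hfin.toFinset)]
  · congr 1
    simp only [Pi.single_apply, apply_ite ENNReal.ofReal, ENNReal.ofReal_one, ENNReal.ofReal_zero]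
  · intro r hr
    rcases lt_or_ge (G.time r) (G.time q') with h | h
    · rw [coef_of_time_lt h, ENNReal.ofReal_zero, mul_zero]
    · rw [chainKernel_of_le (le_of_not_gt fun h' => hr (hfin.mem_toFinset.2 ⟨h, h'⟩)), zero_mul]

theorem ofReal_coef [DecidableEq P] (hM : M.IsLinear) (q q' : P × ℤ) :
    ENNReal.ofReal (coef G M q q') = potential (chainKernel G M) (Pi.single q' 1) q :=
  congrFun (eq_potential (ofReal_coef_eq_add_kernelOp hM q') <| potential_chainKernel_ne_top
    (fun _ => ENNReal.ofReal_ne_top) fun q h => by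
      rw [coef_of_time_lt h, ENNReal.ofReal_zero]) q

theorem potential_chainKernel_eq_tsum_coef (hM : M.IsLinear) (g : P × ℤ → ℝ≥0∞) (q : P × ℤ) :
    potential (chainKernel G M) g q = ∑' q', ENNReal.ofReal (coef G M q q') * g q' := by
  classical
  simpa only [ofReal_coef hM] using potential_eq_tsum_single _ g q

theorem tsum_pastClosed_coef_mul (hM : M.IsLinear) (t₀ : WithBot ℝ) (g : P × ℤ → ℝ≥0∞)
    (q : P × ℤ) :
    ∑' q' : G.pastClosed t₀ (G.time q), ENNReal.ofReal (coef G M q q') * g q' =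
      potential (chainKernel G M) ((G.since t₀).indicator g) q := by
  rw [potential_chainKernel_eq_tsum_coef hM, tsum_subtype (G.pastClosed t₀ (G.time q))
    fun q' => ENNReal.ofReal (coef G M q q') * g q']
  refine tsum_congr fun q' => ?_
  by_cases h₀ : q' ∈ G.since t₀
  · rcases le_or_gt (G.time q') (G.time q) with h | h
    · rw [indicator_of_mem (show q' ∈ G.pastClosed t₀ (G.time q) from ⟨h₀, h⟩),
        indicator_of_mem h₀]
    · rw [indicator_of_notMem fun hq : q' ∈ G.pastClosed t₀ (G.time q) => hq.2.not_gt h,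
        coef_of_time_lt h, ENNReal.ofReal_zero, zero_mul]
  · rw [indicator_of_notMem fun hq : q' ∈ G.pastClosed t₀ (G.time q) => h₀ hq.1,
      indicator_of_notMem h₀, mul_zero]

end Coef

theorem potential_chainKernel_comp_fst_le [Fintype P] [DecidableEq P] (hM : M.IsLinear)
    (h : M.Spec11 G) (u : P → ℝ≥0∞) (q : P × ℤ) :
    potential (chainKernel G M) (u ∘ Prod.fst) q ≤
      ∑ p, ENNReal.ofReal ((1 - M.HWW G)⁻¹ q.1 p) * u p := by
  have kernelOp_comp_le (u : P → ℝ≥0∞) : kernelOp (chainKernel G M) (u ∘ Prod.fst) ≤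
      kernelOp (fun p p' => ENNReal.ofReal (M.HWW G p p')) u ∘ Prod.fst := fun q => by
    simp only [Function.comp_apply, kernelOp_apply, ENNReal.tsum_prod', ENNReal.tsum_mul_right,
      hM.ofReal_HWW (h.1 _ _)]
    exact ENNReal.tsum_le_tsum fun p' => mul_le_mul_left (tsum_chainKernel_le q p') _
  exact (potential_comp_le kernelOp_comp_le u q).trans
    (potential_ofReal_le (M.HWW_nonneg G) h.2 u q.1)

end ChainKernel

section Cascade

variable {N P : Type*} {G : Grid P} {M : Params N P}

/-- The total influence on the value of the chains at `q = (p, k)`, direct or through other chains,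
of a point of the node `m` at time `s`: this is `ℍ^m_{p,k}(t₀, s)`, for any `t₀ ≤ s`. -/
noncomputable def cascade (G : Grid P) (M : Params N P) (m : N) (s : ℝ) : P × ℤ → ℝ≥0∞ :=
  potential (chainKernel G M) fun q => causal (M.h (Sum.inr q.1) (Sum.inl m)) (G.time q - s)

theorem cascade_of_le {m : N} {s : ℝ} {q : P × ℤ} (h : G.time q ≤ s) : cascade G M m s q = 0 :=
  potential_chainKernel_eq_zero (isLowerSet_Iic s)
    (fun _ hr => causal_of_nonpos (sub_nonpos.2 hr) _) h

theorem cascade_shift (m : N) (s : ℝ) (l : ℤ) (q : P × ℤ) :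
    cascade G M m (s + l) (G.shift l q) = cascade G M m s q := by
  have source_shift : (fun q => causal (M.h (Sum.inr q.1) (Sum.inl m)) (G.time q - (s + l))) ∘
      G.shift l = fun q => causal (M.h (Sum.inr q.1) (Sum.inl m)) (G.time q - s) := by
    ext q
    rw [Function.comp_apply, Grid.time_shift, add_sub_add_right_eq_sub]
    rfl
  rw [cascade, cascade, ← source_shift, potential_comp_equiv _ (chainKernel_shift l),
    Function.comp_apply]

variable [Fintype P]

theorem Hpt_eq_cascade (hM : M.IsLinear) (m : N) {t₀ : WithBot ℝ} {s : ℝ}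
    (hs : t₀ ≤ (s : WithBot ℝ)) (q : P × ℤ) : Hpt G M t₀ m q s = cascade G M m s q := by
  rw [Hpt, tsum_pastClosed_coef_mul hM t₀ fun q' => if s < G.time q' then
    ENNReal.ofReal (M.h (Sum.inr q'.1) (Sum.inl m) (G.time q' - s)) else 0, cascade]
  congr 1
  ext r
  rcases lt_or_ge s (G.time r) with h | h
  · have hr : r ∈ G.since t₀ := hs.trans (WithBot.coe_le_coe.2 h.le)
    rw [indicator_of_mem hr, if_pos h, hM.ofReal_h _ _ (sub_pos.2 h)]
  · rw [causal_of_nonpos (sub_nonpos.2 h), indicator_apply_eq_zero]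
    exact fun _ => if_neg h.not_gt

theorem cascade_eq_tsum (hM : M.IsLinear) (m : N) (s : ℝ) (q : P × ℤ) :
    cascade G M m s q = ∑' q' : {q' : P × ℤ // s < G.time q' ∧ G.time q' ≤ G.time q},
      ENNReal.ofReal (coef G M q q') *
        ENNReal.ofReal (M.h (Sum.inr q'.1.1) (Sum.inl m) (G.time q' - s)) := by
  have ofReal_source (q' : {q' : P × ℤ // s < G.time q' ∧ G.time q' ≤ G.time q}) :=
    hM.ofReal_h (Sum.inr q'.1.1) (Sum.inl m) (sub_pos.2 q'.2.1)
  rw [cascade, potential_chainKernel_eq_tsum_coef hM]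
  simp only [ofReal_source]
  exact .symm <| tsum_subtype_eq_of_support_subset (f := fun q' => ENNReal.ofReal (coef G M q q') *
    causal (M.h (Sum.inr q'.1) (Sum.inl m)) (G.time q' - s)) fun q' hq' =>
    ⟨lt_of_not_ge fun h => right_ne_zero_of_mul hq' (causal_of_nonpos (sub_nonpos.2 h) _),
      le_of_not_gt fun h => left_ne_zero_of_mul hq' (by
        rw [coef_of_time_lt h, ENNReal.ofReal_zero])⟩

theorem clusterFun_eq (hM : M.IsLinear) (m m₀ : N) {s t : ℝ} (hst : s < t) :
    clusterFun G M m m₀ s t = causal (M.h (Sum.inl m) (Sum.inl m₀)) (t - s) +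
      ∑' q : P × ℤ, causal (M.h (Sum.inl m) (Sum.inr q.1)) (t - G.time q) *
        (ENNReal.ofReal (M.a (Sum.inl m) q.1) * cascade G M m₀ s q) := by
  have ofReal_mul_h (q : {q : P × ℤ // s < G.time q ∧ G.time q < t}) :
      ENNReal.ofReal (M.a (Sum.inl m) q.1.1 * M.h (Sum.inl m) (Sum.inr q.1.1) (t - G.time q)) =
      causal (M.h (Sum.inl m) (Sum.inr q.1.1)) (t - G.time q) *
        ENNReal.ofReal (M.a (Sum.inl m) q.1.1) := by
    rw [ENNReal.ofReal_mul (M.a_nonneg _ _), hM.ofReal_h _ _ (sub_pos.2 q.2.2), mul_comm]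
  rw [clusterFun, hM.ofReal_h _ _ (sub_pos.2 hst)]
  simp only [mul_assoc, ENNReal.tsum_mul_left, ← cascade_eq_tsum hM, ofReal_mul_h]
  congr 1
  exact tsum_subtype_eq_of_support_subset (f := fun q : P × ℤ =>
    causal (M.h (Sum.inl m) (Sum.inr q.1)) (t - G.time q) *
      (ENNReal.ofReal (M.a (Sum.inl m) q.1) * cascade G M m₀ s q)) fun q hq =>
    ⟨lt_of_not_ge fun h => right_ne_zero_of_mul (right_ne_zero_of_mul hq) (cascade_of_le h),
      lt_of_not_ge fun h => left_ne_zero_of_mul hq (causal_of_nonpos (sub_nonpos.2 h) _)⟩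

theorem clusterFun_add_one (hM : M.IsLinear) (m m₀ : N) {s t : ℝ} (hst : s < t) :
    clusterFun G M m m₀ (s + 1) (t + 1) = clusterFun G M m m₀ s t := by
  have cascade_shift_one (q : P × ℤ) :
      cascade G M m₀ (s + 1) (G.shift 1 q) = cascade G M m₀ s q := by
    simpa only [Int.cast_one] using cascade_shift m₀ s 1 q
  have time_shift_one (q : P × ℤ) : G.time (G.shift 1 q) = G.time q + 1 := by
    simpa only [Int.cast_one] using G.time_shift 1 q
  rw [clusterFun_eq hM _ _ hst, clusterFun_eq hM _ _ (by gcongr), add_sub_add_right_eq_sub,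
    ← (G.shift 1).tsum_eq]
  simp only [cascade_shift_one, time_shift_one, add_sub_add_right_eq_sub]
  rfl

end Cascade

/-- The points of `S` from the time `t₀` on. -/
def pointsSince (t₀ : WithBot ℝ) (S : Set ℝ) : Set ℝ := {s | s ∈ S ∧ t₀ ≤ (s : WithBot ℝ)}

theorem tsum_past_eq (t₀ : WithBot ℝ) {t : ℝ} (S : Set ℝ) {f : ℝ → ℝ≥0∞}
    (hf : ∀ s, t ≤ s → f s = 0) : ∑' s : past t₀ t S, f s = ∑' s : pointsSince t₀ S, f s := by
  rw [tsum_subtype, tsum_subtype]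
  refine tsum_congr fun s => ?_
  by_cases hs : s ∈ pointsSince t₀ S
  · rw [indicator_of_mem hs]
    rcases lt_or_ge s t with h | h
    · exact indicator_of_mem (show s ∈ past t₀ t S from ⟨hs.1, hs.2, h⟩) f
    · rw [indicator_of_notMem fun hs : s ∈ past t₀ t S => hs.2.2.not_ge h, hf s h]
  · rw [indicator_of_notMem hs, indicator_of_notMem fun h : s ∈ past t₀ t S => hs ⟨h.1, h.2.1⟩]

theorem ofReal_neg_tsum_le {ι : Type*} {y : ι → ℝ} (hy : Summable y) :
    ENNReal.ofReal (-∑' i, y i) ≤ ∑' i, ENNReal.ofReal (-y i) := by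
  have h : HasSum (fun i => -y i) (-∑' i, y i) := hy.hasSum.neg
  refine le_of_tendsto' (ENNReal.tendsto_ofReal h) fun F => ?_
  refine le_trans ?_ (ENNReal.sum_le_tsum F)
  exact Finset.le_sum_of_subadditive _ ENNReal.ofReal_zero.le (fun _ _ => ENNReal.ofReal_add_le) F _

section Path

variable {Ω N P : Type*} {G : Grid P} {M : Params N P} {t₀ : WithBot ℝ}

theorem tsum_past_chainKernel_mul (q : P × ℤ) (w : P × ℤ → ℝ≥0∞) :
    ∑' r : G.past t₀ (G.time q),
      causal (M.h (Sum.inr q.1) (Sum.inr r.1.1)) (G.time q - G.time r) *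
        (ENNReal.ofReal (M.a (Sum.inr q.1) r.1.1) * w r) =
      kernelOp (chainKernel G M) ((G.since t₀).indicator w) q := by
  rw [G.tsum_past_causal_mul t₀ (G.time q) (fun p => M.h (Sum.inr q.1) (Sum.inr p))
    fun r => ENNReal.ofReal (M.a (Sum.inr q.1) r.1) * w r, kernelOp_apply]
  refine tsum_congr fun r => ?_
  rw [indicator_mul_right, chainKernel]
  ring

theorem tsum_past_Hpt [Fintype P] (hM : M.IsLinear) (m : N) (q : P × ℤ) (S : Set ℝ) :
    ∑' s : past t₀ (G.time q) S, Hpt G M t₀ m q s =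
      ∑' s : pointsSince t₀ S, cascade G M m s q := by
  rw [← tsum_past_eq t₀ S fun s hs => cascade_of_le hs]
  exact tsum_congr fun s => Hpt_eq_cascade hM m s.2.2.1 q

theorem tsum_cascade_of_notMem_since (m : N) (S : Set ℝ) {q : P × ℤ} (hq : q ∉ G.since t₀) :
    ∑' s : pointsSince t₀ S, cascade G M m s q = 0 :=
  ENNReal.tsum_eq_zero.2 fun s =>
    cascade_of_le (WithBot.coe_le_coe.1 ((le_of_not_ge hq).trans s.2.2))

theorem tsum_past_clusterFun [Fintype P] (hM : M.IsLinear) (m m₀ : N) (t : ℝ) (S : Set ℝ) :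
    ∑' s : past t₀ t S, clusterFun G M m m₀ s t =
      ∑' s : past t₀ t S, causal (M.h (Sum.inl m) (Sum.inl m₀)) (t - s) +
        ∑' q : G.past t₀ t, causal (M.h (Sum.inl m) (Sum.inr q.1.1)) (t - G.time q) *
          (ENNReal.ofReal (M.a (Sum.inl m) q.1.1) *
            ∑' s : past t₀ (G.time q) S, Hpt G M t₀ m₀ q s) := by
  let direct (s : ℝ) : ℝ≥0∞ := causal (M.h (Sum.inl m) (Sum.inl m₀)) (t - s)
  let weight (q : P × ℤ) : ℝ≥0∞ := causal (M.h (Sum.inl m) (Sum.inr q.1)) (t - G.time q)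
  let gain (q : P × ℤ) : ℝ≥0∞ := ENNReal.ofReal (M.a (Sum.inl m) q.1)
  have summand_eq_zero (s : ℝ) (hs : t ≤ s) (q : P × ℤ) :
      weight q * (gain q * cascade G M m₀ s q) = 0 := by
    rcases le_or_gt t (G.time q) with h | h
    · rw [show weight q = 0 from causal_of_nonpos (sub_nonpos.2 h) _, zero_mul]
    · rw [cascade_of_le (h.le.trans hs), mul_zero, mul_zero]
  let influence (q : P × ℤ) : ℝ≥0∞ := gain q * ∑' s : pointsSince t₀ S, cascade G M m₀ s q
  have influence_indicator : (G.since t₀).indicator influence = influence := by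
    refine indicator_eq_self.2 (Function.support_subset_iff'.2 fun q hq => ?_)
    rw [show influence q = _ * _ from rfl, tsum_cascade_of_notMem_since m₀ S hq, mul_zero]
  calc ∑' s : past t₀ t S, clusterFun G M m m₀ s t
      = ∑' s : past t₀ t S, (direct s + ∑' q, weight q * (gain q * cascade G M m₀ s q)) :=
        tsum_congr fun s => clusterFun_eq hM m m₀ s.2.2.2
    _ = ∑' s : past t₀ t S, direct s +
          ∑' s : past t₀ t S, ∑' q, weight q * (gain q * cascade G M m₀ s q) := ENNReal.tsum_add
    _ = ∑' s : past t₀ t S, direct s +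
          ∑' s : pointsSince t₀ S, ∑' q, weight q * (gain q * cascade G M m₀ s q) := by
        rw [tsum_past_eq t₀ S fun s hs => ENNReal.tsum_eq_zero.2 (summand_eq_zero s hs)]
    _ = ∑' s : past t₀ t S, direct s + ∑' q, weight q * influence q := by
        rw [ENNReal.tsum_comm]
        simp only [ENNReal.tsum_mul_left, influence]
    _ = ∑' s : past t₀ t S, direct s + ∑' q : G.past t₀ t, weight q * influence q := by
        rw [G.tsum_past_causal_mul t₀ t (fun p => M.h (Sum.inl m) (Sum.inr p)) influence,
          influence_indicator]
    _ = _ := by simp only [tsum_past_Hpt hM]; rfl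

variable [Fintype N] {X : Triple Ω N P} {ω : Ω} {x : P × ℤ → ℝ}

namespace Triple

theorem input_nonneg (hM : M.IsLinear) (hW : ∀ q ∈ G.since t₀, 0 ≤ X.W q ω) (α : N ⊕ P) (t : ℝ) :
    0 ≤ X.input G M t₀ α t ω := by
  refine add_nonneg (Finset.sum_nonneg fun m _ => tsum_nonneg fun s => ?_) (tsum_nonneg fun q => ?_)
  · exact hM.h_nonneg _ _ _ (sub_pos.2 s.2.2.2)
  · rw [hM.mask_eq]
    exact mul_nonneg (hM.h_nonneg _ _ _ (sub_pos.2 q.2.2))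
      (add_nonneg (mul_nonneg (M.a_nonneg _ _) (hW _ q.2.1)) (hM.b_nonneg _ _))

theorem ofReal_input (hM : M.IsLinear) (hW : ∀ q ∈ G.since t₀, 0 ≤ X.W q ω) {α : N ⊕ P} {t : ℝ}
    (hc : X.InputConverges G M t₀ α t ω) :
    ENNReal.ofReal (X.input G M t₀ α t ω) =
      ∑ m, ∑' s : past t₀ t (X.S m ω), causal (M.h α (Sum.inl m)) (t - s) +
        ∑' q : G.past t₀ t, causal (M.h α (Sum.inr q.1.1)) (t - G.time q) *
          (ENNReal.ofReal (M.a α q.1.1) * ENNReal.ofReal (X.W q ω) +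
            ENNReal.ofReal (M.b α q.1.1)) := by
  have point_nonneg (m : N) (s : past t₀ t (X.S m ω)) : 0 ≤ M.h α (Sum.inl m) (t - s) :=
    hM.h_nonneg _ _ _ (sub_pos.2 s.2.2.2)
  have h_nonneg (q : G.past t₀ t) : 0 ≤ M.h α (Sum.inr q.1.1) (t - G.time q) :=
    hM.h_nonneg _ _ _ (sub_pos.2 q.2.2)
  have aW_nonneg (q : G.past t₀ t) : 0 ≤ M.a α q.1.1 * X.W q ω :=
    mul_nonneg (M.a_nonneg _ _) (hW _ q.2.1)
  have mask_nonneg (q : G.past t₀ t) : 0 ≤ M.κ α q.1.1 (X.W q ω) := by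
    rw [hM.mask_eq]
    exact add_nonneg (aW_nonneg q) (hM.b_nonneg _ _)
  rw [input, ENNReal.ofReal_add (Finset.sum_nonneg fun m _ => tsum_nonneg (point_nonneg m))
    (tsum_nonneg fun q => mul_nonneg (h_nonneg q) (mask_nonneg q)),
    ENNReal.ofReal_sum_of_nonneg fun m _ => tsum_nonneg (point_nonneg m),
    ENNReal.ofReal_tsum_of_nonneg (fun q => mul_nonneg (h_nonneg q) (mask_nonneg q)) hc.2]
  congr 1
  · refine Finset.sum_congr rfl fun m _ => ?_
    rw [ENNReal.ofReal_tsum_of_nonneg (point_nonneg m) (hc.1 m)]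
    exact tsum_congr fun s => hM.ofReal_h _ _ (sub_pos.2 s.2.2.2)
  · refine tsum_congr fun q => ?_
    rw [ENNReal.ofReal_mul (h_nonneg q), hM.mask_eq, ENNReal.ofReal_add (aW_nonneg q)
      (hM.b_nonneg _ _), ENNReal.ofReal_mul (M.a_nonneg _ _), hM.ofReal_h _ _ (sub_pos.2 q.2.2)]

/-- For the realization `ω`, the chains satisfy their equations from the time `t₀` on, with the
drifts `x`. -/
def SolvesChains (X : Triple Ω N P) (G : Grid P) (M : Params N P) (t₀ : WithBot ℝ)
    (x : P × ℤ → ℝ) (ω : Ω) : Prop :=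
  ∀ q ∈ G.since t₀, X.InputConverges G M t₀ (Sum.inr q.1) (G.time q) ω ∧
    X.W q ω = x q + M.Φ (Sum.inr q.1) (X.input G M t₀ (Sum.inr q.1) (G.time q) ω)

theorem SolvesChains.ofReal_neg_le (hX : X.SolvesChains G M t₀ x ω) (hM : M.IsLinear)
    (hx : ∀ q, 0 ≤ x q) {q : P × ℤ} (hq : q ∈ G.since t₀) :
    ENNReal.ofReal (-X.W q ω) ≤ kernelOp (chainKernel G M)
      ((G.since t₀).indicator fun r => ENNReal.ofReal (-X.W r ω)) q := by
  obtain ⟨hc, hW⟩ := hX q hq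
  rw [hM.link_chain, id, input] at hW
  have nodes_nonneg : 0 ≤ ∑ m, ∑' s : past t₀ (G.time q) (X.S m ω),
      M.h (Sum.inr q.1) (Sum.inl m) (G.time q - s) :=
    Finset.sum_nonneg fun m _ => tsum_nonneg fun s => hM.h_nonneg _ _ _ (sub_pos.2 s.2.2.2)
  have ofReal_neg_term_le (r : G.past t₀ (G.time q)) :
      ENNReal.ofReal (-(M.h (Sum.inr q.1) (Sum.inr r.1.1) (G.time q - G.time r) *
        M.κ (Sum.inr q.1) r.1.1 (X.W r ω))) ≤
      causal (M.h (Sum.inr q.1) (Sum.inr r.1.1)) (G.time q - G.time r) *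
        (ENNReal.ofReal (M.a (Sum.inr q.1) r.1.1) * ENNReal.ofReal (-X.W r ω)) := by
    rw [← hM.ofReal_h _ _ (sub_pos.2 r.2.2), ← ENNReal.ofReal_mul (M.a_nonneg _ _),
      ← ENNReal.ofReal_mul (hM.h_nonneg _ _ _ (sub_pos.2 r.2.2)), ← mul_neg, hM.mask_eq]
    gcongr
    · exact hM.h_nonneg _ _ _ (sub_pos.2 r.2.2)
    · linarith [hM.b_nonneg (Sum.inr q.1) r.1.1]
  calc ENNReal.ofReal (-X.W q ω)
      ≤ ENNReal.ofReal (-∑' r : G.past t₀ (G.time q),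
          M.h (Sum.inr q.1) (Sum.inr r.1.1) (G.time q - G.time r) *
            M.κ (Sum.inr q.1) r.1.1 (X.W r ω)) :=
        ENNReal.ofReal_le_ofReal (by linarith [hx q])
    _ ≤ _ := ofReal_neg_tsum_le hc.2
    _ ≤ _ := ENNReal.tsum_le_tsum ofReal_neg_term_le
    _ = _ := tsum_past_chainKernel_mul q fun r => ENNReal.ofReal (-X.W r ω)

theorem SolvesChains.nonneg (hX : X.SolvesChains G M t₀ x ω) (hM : M.IsLinear)
    (hx : ∀ q, 0 ≤ x q)
    (hfin : ∀ q, potential (chainKernel G M) ((G.since t₀).indicator fun r => ‖X.W r ω‖ₑ) q ≠ ∞)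
    {q : P × ℤ} (hq : q ∈ G.since t₀) : 0 ≤ X.W q ω := by
  have negPart_eq_zero : (G.since t₀).indicator (fun r => ENNReal.ofReal (-X.W r ω)) = 0 :=
    eq_zero_of_le_kernelOp
      (indicator_le fun q hq => hX.ofReal_neg_le hM hx hq) fun q =>
      ne_top_of_le_ne_top (hfin q) <| potential_mono _ (indicator_mono fun r =>
        (Real.ofReal_le_enorm _).trans_eq (enorm_neg _)) q
  have := congrFun negPart_eq_zero q
  rw [indicator_of_mem hq, Pi.zero_apply, ENNReal.ofReal_eq_zero] at this
  linarith

theorem SolvesChains.ofReal_eq_add_kernelOp (hX : X.SolvesChains G M t₀ x ω) (hM : M.IsLinear)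
    (hx : ∀ q, 0 ≤ x q) (hW : ∀ q ∈ G.since t₀, 0 ≤ X.W q ω) :
    (G.since t₀).indicator (fun q => ENNReal.ofReal (X.W q ω)) =
      (G.since t₀).indicator (fun q => ∑' r : G.past t₀ (G.time q),
        ENNReal.ofReal (M.b (Sum.inr q.1) r.1.1 *
          M.h (Sum.inr q.1) (Sum.inr r.1.1) (G.time q - G.time r))) +
      (G.since t₀).indicator (fun q => ENNReal.ofReal (x q)) +
      (fun q => ∑' m, ∑' s : pointsSince t₀ (X.S m ω),
        causal (M.h (Sum.inr q.1) (Sum.inl m)) (G.time q - s)) +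
      kernelOp (chainKernel G M) ((G.since t₀).indicator fun q => ENNReal.ofReal (X.W q ω)) := by
  ext q
  simp only [Pi.add_apply, ← tsum_past_chainKernel_mul]
  by_cases hq : q ∈ G.since t₀
  · obtain ⟨hc, hXW⟩ := hX q hq
    rw [hM.link_chain, id] at hXW
    have mask_offset (r : G.past t₀ (G.time q)) :
        ENNReal.ofReal (M.b (Sum.inr q.1) r.1.1 *
          M.h (Sum.inr q.1) (Sum.inr r.1.1) (G.time q - G.time r)) =
        causal (M.h (Sum.inr q.1) (Sum.inr r.1.1)) (G.time q - G.time r) *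
          ENNReal.ofReal (M.b (Sum.inr q.1) r.1.1) := by
      rw [ENNReal.ofReal_mul (hM.b_nonneg _ _), hM.ofReal_h _ _ (sub_pos.2 r.2.2), mul_comm]
    have points (m : N) := tsum_past_eq t₀ (X.S m ω) (t := G.time q)
      (f := fun s => causal (M.h (Sum.inr q.1) (Sum.inl m)) (G.time q - s))
      fun s hs => causal_of_nonpos (sub_nonpos.2 hs) _
    simp only [indicator_of_mem hq, mask_offset, tsum_fintype (L := .unconditional N), ← points]
    rw [hXW, ENNReal.ofReal_add (hx q) (input_nonneg hM hW _ _), ofReal_input hM hW hc]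
    simp only [mul_add, ENNReal.tsum_add]
    ring
  · have past_empty (r : G.past t₀ (G.time q)) : False :=
      hq (r.2.1.trans (WithBot.coe_le_coe.2 r.2.2.le))
    have points_after (m : N) (s : pointsSince t₀ (X.S m ω)) :
        causal (M.h (Sum.inr q.1) (Sum.inl m)) (G.time q - s) = 0 :=
      causal_of_nonpos (sub_nonpos.2 (WithBot.coe_le_coe.1 ((le_of_not_ge hq).trans s.2.2))) _
    have : IsEmpty (G.past t₀ (G.time q)) := ⟨past_empty⟩
    simp only [indicator_of_notMem hq, points_after, tsum_zero, tsum_empty, add_zero]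

theorem SolvesChains.ofReal_eq [Fintype P] (hX : X.SolvesChains G M t₀ x ω) (hM : M.IsLinear)
    (hx : ∀ q, 0 ≤ x q) (hW : ∀ q ∈ G.since t₀, 0 ≤ X.W q ω)
    (hfin : ∀ q, potential (chainKernel G M) ((G.since t₀).indicator fun r => ‖X.W r ω‖ₑ) q ≠ ∞)
    {q : P × ℤ} (hq : q ∈ G.since t₀) :
    ENNReal.ofReal (X.W q ω) = Hb G M t₀ q + Hxi G M t₀ x q +
      ∑ m, ∑' s : past t₀ (G.time q) (X.S m ω), Hpt G M t₀ m q s := by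
  have eq_pot := congrFun (eq_potential (hX.ofReal_eq_add_kernelOp hM hx hW) fun q =>
    ne_top_of_le_ne_top (hfin q) <| potential_mono _ (indicator_mono fun r =>
      Real.ofReal_le_enorm _) q) q
  rw [indicator_of_mem hq, potential_add, potential_add, Pi.add_apply, Pi.add_apply] at eq_pot
  simp only [potential_tsum] at eq_pot
  rw [eq_pot, ← tsum_pastClosed_coef_mul hM, ← tsum_pastClosed_coef_mul hM,
    tsum_fintype (L := .unconditional N)]
  simp only [tsum_past_Hpt hM]
  rfl

theorem lam_eq (hM : M.IsLinear) (hW : ∀ q ∈ G.since t₀, 0 ≤ X.W q ω) {m : N} {t : ℝ}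
    (hlam : X.lam m t ω = M.Φ (Sum.inl m) (M.μ m + X.input G M t₀ (Sum.inl m) t ω)) :
    X.lam m t ω = M.μ m + X.input G M t₀ (Sum.inl m) t ω := by
  rcases hM.link_node m with h | h
  · rw [hlam, h, id]
  · rw [hlam, h]
    exact max_eq_left (add_nonneg (hM.μ_nonneg m) (input_nonneg hM hW _ _))

theorem ofReal_rate_eq [Fintype P] (hM : M.IsLinear) (hW : ∀ q ∈ G.since t₀, 0 ≤ X.W q ω)
    (hWx : ∀ q ∈ G.since t₀, ENNReal.ofReal (X.W q ω) = Hb G M t₀ q + Hxi G M t₀ x q +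
      ∑ m, ∑' s : past t₀ (G.time q) (X.S m ω), Hpt G M t₀ m q s) {m : N} {t : ℝ}
    (hc : X.InputConverges G M t₀ (Sum.inl m) t ω) :
    ENNReal.ofReal (M.μ m + X.input G M t₀ (Sum.inl m) t ω) = immigrantRate G M t₀ x m t +
      ∑ m', ∑' s : past t₀ t (X.S m' ω), clusterFun G M m m' s t := by
  have chain_term (q : G.past t₀ t) :
      causal (M.h (Sum.inl m) (Sum.inr q.1.1)) (t - G.time q) *
        (ENNReal.ofReal (M.a (Sum.inl m) q.1.1) * ENNReal.ofReal (X.W q ω) +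
          ENNReal.ofReal (M.b (Sum.inl m) q.1.1)) =
      ENNReal.ofReal (M.h (Sum.inl m) (Sum.inr q.1.1) (t - G.time q)) *
        (ENNReal.ofReal (M.a (Sum.inl m) q.1.1) * Hb G M t₀ q +
          ENNReal.ofReal (M.a (Sum.inl m) q.1.1) * Hxi G M t₀ x q +
          ENNReal.ofReal (M.b (Sum.inl m) q.1.1)) +
      ∑ m', causal (M.h (Sum.inl m) (Sum.inr q.1.1)) (t - G.time q) *
        (ENNReal.ofReal (M.a (Sum.inl m) q.1.1) *
          ∑' s : past t₀ (G.time q) (X.S m' ω), Hpt G M t₀ m' q s) := by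
    rw [hWx q q.2.1, hM.ofReal_h _ _ (sub_pos.2 q.2.2), ← Finset.mul_sum, ← Finset.mul_sum]
    ring
  rw [ENNReal.ofReal_add (hM.μ_nonneg m) (input_nonneg hM hW _ _), ofReal_input hM hW hc,
    tsum_congr chain_term, ENNReal.tsum_add, Summable.tsum_finsetSum fun _ _ => ENNReal.summable,
    immigrantRate]
  simp only [tsum_past_clusterFun hM, Finset.sum_add_distrib]
  ring

end Triple

end Path

section ClusterMass

variable {N P : Type*} [Fintype P] {G : Grid P} {M : Params N P}

theorem tsum_cascade_sub_le [DecidableEq P] (hM : M.IsLinear) (h : M.Spec11 G) (m : N) (s : ℝ)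
    (q : P × ℤ) : ∑' l : ℤ, cascade G M m (s - l) q ≤
      ∑ p, ENNReal.ofReal ((1 - M.HWW G)⁻¹ q.1 p) *
        normLattice (M.h (Sum.inr p) (Sum.inl m)) 1 := by
  simp only [cascade, ← potential_tsum]
  refine (potential_mono _ (fun r => ?_) q).trans (potential_chainKernel_comp_fst_le hM h
    (fun p => normLattice (M.h (Sum.inr p) (Sum.inl m)) 1) q)
  simpa only [Function.comp_apply, sub_sub_eq_add_sub, add_sub_right_comm, Nat.cast_one, div_one]
    using tsum_causal_le_normLattice (M.h (Sum.inr r.1) (Sum.inl m)) 1 (G.time r - s)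

theorem tsum_cascade_le [DecidableEq P] (hM : M.IsLinear) (h : M.Spec11 G) (m : N) (s : ℝ)
    (p : P) : ∑' j : ℤ, cascade G M m s (p, j) ≤
      G.n p * ∑ p', ENNReal.ofReal ((1 - M.HWW G)⁻¹ p p') *
        normLattice (M.h (Sum.inr p') (Sum.inl m)) 1 := by
  have : NeZero (G.n p) := ⟨(G.n_pos p).ne'⟩
  have shift_index (l : ℤ) (i : Fin (G.n p)) :
      (p, (Int.divModEquiv (G.n p)).symm (l, i)) = G.shift l (p, (i : ℤ)) := by
    simp only [Int.divModEquiv, Fin.ofNat_eq_cast, Equiv.symm_mk, Equiv.coe_fn_mk, Grid.shift,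
      Equiv.prodShear_apply, Equiv.refl_apply, Equiv.coe_addRight, Prod.mk.injEq, true_and]
    ring
  have cascade_shift_back (l : ℤ) (q : P × ℤ) :
      cascade G M m s (G.shift l q) = cascade G M m (s - l) q := by
    rw [← cascade_shift m (s - l) l q, sub_add_cancel]
  calc ∑' j : ℤ, cascade G M m s (p, j)
      = ∑' i : Fin (G.n p), ∑' l : ℤ, cascade G M m (s - l) (p, (i : ℤ)) := by
        rw [← (Int.divModEquiv (G.n p)).symm.tsum_eq, ENNReal.tsum_prod', ENNReal.tsum_comm]
        simp only [shift_index, cascade_shift_back]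
    _ ≤ ∑' _ : Fin (G.n p), ∑ p', ENNReal.ofReal ((1 - M.HWW G)⁻¹ p p') *
          normLattice (M.h (Sum.inr p') (Sum.inl m)) 1 :=
        ENNReal.tsum_le_tsum fun i => tsum_cascade_sub_le hM h m s (p, (i : ℤ))
    _ = _ := by
        rw [tsum_fintype, Finset.sum_const, Finset.card_univ, Fintype.card_fin, nsmul_eq_mul]

theorem lintegral_clusterFun_le_tsum (hM : M.IsLinear) (m m₀ : N) (s : ℝ) :
    ∫⁻ t in Ioi s, clusterFun G M m m₀ s t ≤ normL1 (M.h (Sum.inl m) (Sum.inl m₀)) +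
      ∑ p, normL1 (M.h (Sum.inl m) (Sum.inr p)) * (ENNReal.ofReal (M.a (Sum.inl m) p) *
        ∑' j : ℤ, cascade G M m₀ s (p, j)) := by
  have measurable_causal_sub (β : N ⊕ P) (u : ℝ) :
      Measurable fun t => causal (M.h (Sum.inl m) β) (t - u) :=
    (measurable_causal (M.measurable_h _ _)).comp (measurable_id.sub_const u)
  calc ∫⁻ t in Ioi s, clusterFun G M m m₀ s t
      = ∫⁻ t in Ioi s, (causal (M.h (Sum.inl m) (Sum.inl m₀)) (t - s) +
          ∑' q : P × ℤ, causal (M.h (Sum.inl m) (Sum.inr q.1)) (t - G.time q) *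
            (ENNReal.ofReal (M.a (Sum.inl m) q.1) * cascade G M m₀ s q)) :=
        setLIntegral_congr_fun measurableSet_Ioi fun t ht => clusterFun_eq hM m m₀ ht
    _ ≤ ∫⁻ t, (causal (M.h (Sum.inl m) (Sum.inl m₀)) (t - s) +
          ∑' q : P × ℤ, causal (M.h (Sum.inl m) (Sum.inr q.1)) (t - G.time q) *
            (ENNReal.ofReal (M.a (Sum.inl m) q.1) * cascade G M m₀ s q)) :=
        setLIntegral_le_lintegral _ _
    _ = normL1 (M.h (Sum.inl m) (Sum.inl m₀)) +
          ∑' q : P × ℤ, normL1 (M.h (Sum.inl m) (Sum.inr q.1)) *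
            (ENNReal.ofReal (M.a (Sum.inl m) q.1) * cascade G M m₀ s q) := by
        rw [lintegral_add_left (measurable_causal_sub _ _), lintegral_tsum fun q =>
          ((measurable_causal_sub _ _).mul_const _).aemeasurable, lintegral_causal_sub]
        simp only [lintegral_mul_const _ (measurable_causal_sub _ _), lintegral_causal_sub]
    _ = _ := by
        simp only [ENNReal.tsum_prod', ENNReal.tsum_mul_left, tsum_fintype]

theorem lintegral_clusterFun_le [DecidableEq P] (hM : M.IsLinear) (h : M.Spec11 G) (m m₀ : N)
    (s : ℝ) :
    ∫⁻ t in Ioi s, clusterFun G M m m₀ s t ≤ normL1 (M.h (Sum.inl m) (Sum.inl m₀)) +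
      ∑ p, ∑ p', (G.n p : ℝ≥0∞) * ENNReal.ofReal (M.a (Sum.inl m) p) *
        normL1 (M.h (Sum.inl m) (Sum.inr p)) * ENNReal.ofReal ((1 - M.HWW G)⁻¹ p p') *
        normLattice (M.h (Sum.inr p') (Sum.inl m₀)) 1 := by
  refine (lintegral_clusterFun_le_tsum hM m m₀ s).trans ?_
  gcongr with p
  refine (mul_le_mul_right (mul_le_mul_right (tsum_cascade_le hM h m₀ s p) _) _).trans_eq ?_
  simp only [Finset.mul_sum]
  exact Finset.sum_congr rfl fun p' _ => by ring

end ClusterMass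

section RandomPaths

variable {Ω N P : Type*} [MeasurableSpace Ω] {Pr : Measure Ω} {G : Grid P}
  {π : N → Ω → Set (ℝ × ℝ)} {ξ : P × ℤ → Ω → ℝ}

theorem IsDriving.history_le (h : IsDriving Pr G π ξ) (t : ℝ) :
    history G π ξ t ≤ ‹MeasurableSpace Ω› :=
  sup_le (iSup_le fun m => iSup_le fun B => ((h.poisson m).measurable B.1 B.2.1).comap_le)
    (iSup_le fun q => (h.measurable_ξ q.1).comap_le)

theorem ae_potential_chainKernel_enorm_ne_top [Fintype P] [DecidableEq P] {M : Params N P}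
    {W : P × ℤ → Ω → ℝ} (hM : M.IsLinear) (hS : M.Spec11 G) (hmeas : ∀ q, Measurable (W q))
    (hW : ⨆ q, ∫⁻ ω, ‖W q ω‖ₑ ∂Pr < ∞) :
    ∀ᵐ ω ∂Pr, ∀ q, potential (chainKernel G M) (fun r => ‖W r ω‖ₑ) q ≠ ∞ := by
  refine ae_potential_ne_top (fun q => (hmeas q).enorm.aemeasurable) fun q => ?_
  refine ne_top_of_le_ne_top ?_ <| (potential_mono _
    (fun r => le_iSup (fun r => ∫⁻ ω, ‖W r ω‖ₑ ∂Pr) r) q).trans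
    (potential_chainKernel_comp_fst_le hM hS (fun _ => ⨆ q, ∫⁻ ω, ‖W q ω‖ₑ ∂Pr) q)
  exact ENNReal.sum_ne_top.2 fun p _ => ENNReal.mul_ne_top ENNReal.ofReal_ne_top hW.ne

variable [Fintype N] [Fintype P] {M : Params N P} {t₀ : WithBot ℝ} {X : Triple Ω N P}

namespace IsHAR

theorem ae_potential_ne_top [DecidableEq P] (hX : IsHAR Pr G π ξ M t₀ X)
    (hπξ : ∀ t, history G π ξ t ≤ ‹MeasurableSpace Ω›) (hM : M.IsLinear)
    (hbot : t₀ = ⊥ → M.Spec11 G ∧ ⨆ q, ∫⁻ ω, ‖X.W q ω‖ₑ ∂Pr < ∞) :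
    ∀ᵐ ω ∂Pr, ∀ q,
      potential (chainKernel G M) ((G.since t₀).indicator fun r => ‖X.W r ω‖ₑ) q ≠ ∞ := by
  induction t₀ using WithBot.recBotCoe with
  | bot =>
    obtain ⟨hS, hW⟩ := hbot rfl
    have since_bot : G.since ⊥ = univ := eq_univ_of_forall fun q =>
      show ⊥ ≤ (G.time q : WithBot ℝ) from bot_le
    simpa only [since_bot, indicator_univ] using ae_potential_chainKernel_enorm_ne_top hM hS
      (fun q => (hX.adapted_W q bot_le).mono (hπξ _) le_rfl) hW
  | coe t₁ =>
    refine .of_forall fun ω => potential_chainKernel_ne_top (t₁ := t₁) (fun q => ?_) fun q hq => ?_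
    · exact ne_top_of_le_ne_top enorm_ne_top (indicator_le_self _ _ q)
    · exact indicator_of_notMem (fun h : q ∈ G.since t₁ => (WithBot.coe_le_coe.1 h).not_gt hq) _

theorem ae_chains (hX : IsHAR Pr G π ξ M t₀ X) (hM : M.IsLinear)
    (hξ : ∀ᵐ ω ∂Pr, ∀ q, 0 ≤ ξ q ω)
    (hfin : ∀ᵐ ω ∂Pr, ∀ q,
      potential (chainKernel G M) ((G.since t₀).indicator fun r => ‖X.W r ω‖ₑ) q ≠ ∞) :
    ∀ᵐ ω ∂Pr, ∀ q ∈ G.since t₀, 0 ≤ X.W q ω ∧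
      ENNReal.ofReal (X.W q ω) = Hb G M t₀ q + Hxi G M t₀ (fun r => ξ r ω) q +
        ∑ m, ∑' t : past t₀ (G.time q) (X.S m ω), Hpt G M t₀ m q t := by
  filter_upwards [hX.eq_W, hξ, hfin] with ω hW hξω hfinω q hq
  have solves : X.SolvesChains G M t₀ (fun r => ξ r ω) ω := hW
  exact ⟨solves.nonneg hM hξω hfinω hq,
    solves.ofReal_eq hM hξω (fun _ => solves.nonneg hM hξω hfinω) hfinω hq⟩

theorem ae_intensities (hX : IsHAR Pr G π ξ M t₀ X) (hM : M.IsLinear)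
    (hchains : ∀ᵐ ω ∂Pr, ∀ q ∈ G.since t₀, 0 ≤ X.W q ω ∧
      ENNReal.ofReal (X.W q ω) = Hb G M t₀ q + Hxi G M t₀ (fun r => ξ r ω) q +
        ∑ m, ∑' t : past t₀ (G.time q) (X.S m ω), Hpt G M t₀ m q t) :
    ∀ᵐ z ∂(Pr.prod (volume.restrict {t : ℝ | t₀ ≤ (t : WithBot ℝ)})), ∀ m,
      0 ≤ X.lam m z.2 z.1 ∧
      ENNReal.ofReal (X.lam m z.2 z.1) = immigrantRate G M t₀ (fun r => ξ r z.1) m z.2 +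
        ∑ m', ∑' s : past t₀ z.2 (X.S m' z.1), clusterFun G M m m' s z.2 := by
  filter_upwards [hX.eq_lam, Measure.quasiMeasurePreserving_fst.ae hchains] with z hlam hz m
  have W_nonneg : ∀ q ∈ G.since t₀, 0 ≤ X.W q z.1 := fun q hq => (hz q hq).1
  rw [Triple.lam_eq hM W_nonneg (hlam m).2]
  exact ⟨add_nonneg (hM.μ_nonneg m) (Triple.input_nonneg hM W_nonneg _ _),
    Triple.ofReal_rate_eq hM W_nonneg (fun q hq => (hz q hq).2) (hlam m).1⟩

end IsHAR

end RandomPaths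

end HAR

theorem theorem4p5_general {Ω N P : Type*} [MeasurableSpace Ω] [Fintype N] [Fintype P]
    [DecidableEq N] [DecidableEq P]
    (Pr : Measure Ω) (G : HAR.Grid P) (π : N → Ω → Set (ℝ × ℝ)) (ξ : P × ℤ → Ω → ℝ)
    (hπξ : ∀ t, HAR.history G π ξ t ≤ ‹MeasurableSpace Ω›)
    (M : HAR.Params N P) (hM : M.IsLinear) (hξ : ∀ᵐ ω ∂Pr, ∀ q, 0 ≤ ξ q ω) :
    (∀ (t₀ : WithBot ℝ) (X : HAR.Triple Ω N P), HAR.IsHAR Pr G π ξ M t₀ X →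
      (t₀ = ⊥ → M.Spec11 G ∧ ⨆ q, ∫⁻ ω, ‖X.W q ω‖ₑ ∂Pr < ∞) →
      (∀ᵐ ω ∂Pr, ∀ q : P × ℤ, t₀ ≤ (G.time q : WithBot ℝ) →
        0 ≤ X.W q ω ∧
        ENNReal.ofReal (X.W q ω) =
          HAR.Hb G M t₀ q + HAR.Hxi G M t₀ (fun r => ξ r ω) q +
            ∑ m, ∑' t : HAR.past t₀ (G.time q) (X.S m ω), HAR.Hpt G M t₀ m q t) ∧
      (∀ᵐ z ∂(Pr.prod (volume.restrict {t : ℝ | t₀ ≤ (t : WithBot ℝ)})), ∀ m,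
        0 ≤ X.lam m z.2 z.1 ∧
        ENNReal.ofReal (X.lam m z.2 z.1) =
          HAR.immigrantRate G M t₀ (fun r => ξ r z.1) m z.2 +
            ∑ m', ∑' s : HAR.past t₀ z.2 (X.S m' z.1), HAR.clusterFun G M m m' s z.2)) ∧
    (∀ (m m₀ : N) (s t : ℝ), s < t →
      HAR.clusterFun G M m m₀ (s + 1) (t + 1) = HAR.clusterFun G M m m₀ s t) ∧
    (M.Spec1 G → M.Spec11 G) ∧
    (M.Spec11 G → ∀ (m m₀ : N) (s : ℝ),
      ∫⁻ t in Ioi s, HAR.clusterFun G M m m₀ s t ≤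
        HAR.normL1 (M.h (Sum.inl m) (Sum.inl m₀)) +
          ∑ p, ∑ p', (G.n p : ℝ≥0∞) * ENNReal.ofReal (M.a (Sum.inl m) p) *
            HAR.normL1 (M.h (Sum.inl m) (Sum.inr p)) * ENNReal.ofReal ((1 - M.HWW G)⁻¹ p p') *
            HAR.normLattice (M.h (Sum.inr p') (Sum.inl m₀)) 1) := by
  refine ⟨fun t₀ X hX hbot => ?_, fun m m₀ _ _ => HAR.clusterFun_add_one hM m m₀,
    HAR.Params.Spec1.spec11, HAR.lintegral_clusterFun_le hM⟩
  have chains := hX.ae_chains hM hξ (hX.ae_potential_ne_top hπξ hM hbot)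
  exact ⟨chains, hX.ae_intensities hM chains⟩

theorem theorem4p5 {Ω N P : Type*} [MeasurableSpace Ω] [Fintype N] [Fintype P]
    [DecidableEq N] [DecidableEq P]
    (Pr : MeasureTheory.Measure Ω) [MeasureTheory.IsProbabilityMeasure Pr]
    (G : HAR.Grid P) (π : N → Ω → Set (ℝ × ℝ)) (ξ : P × ℤ → Ω → ℝ)
    (hdriving : HAR.IsDriving Pr G π ξ)
    (M : HAR.Params N P) (hM : M.IsLinear)
    (hξ : ∀ᵐ ω ∂Pr, ∀ q, 0 ≤ ξ q ω) :
    -- the process started at `t₀ ∈ {-∞} ∪ ℝ`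
    (∀ (t₀ : WithBot ℝ) (X : HAR.Triple Ω N P), HAR.IsHAR Pr G π ξ M t₀ X →
      (t₀ ≠ ⊥ → M.NoExpl ∧ X.NonExploding Pr) →
      (t₀ = ⊥ → M.Spec1 G ∧ HAR.FiMe Pr ξ ∧ X.BoundedL1 Pr) →
      -- the chains
      (∀ᵐ ω ∂Pr, ∀ q : P × ℤ, t₀ ≤ (G.time q : WithBot ℝ) →
        0 ≤ X.W q ω ∧
        ENNReal.ofReal (X.W q ω) =
          HAR.Hb G M t₀ q + HAR.Hxi G M t₀ (fun r => ξ r ω) q +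
            ∑ m, ∑' t : HAR.past t₀ (G.time q) (X.S m ω), HAR.Hpt G M t₀ m q t) ∧
      -- the intensities
      (∀ᵐ z ∂(Pr.prod (MeasureTheory.volume.restrict {t : ℝ | t₀ ≤ (t : WithBot ℝ)})), ∀ m,
        0 ≤ X.lam m z.2 z.1 ∧
        ENNReal.ofReal (X.lam m z.2 z.1) =
          HAR.immigrantRate G M t₀ (fun r => ξ r z.1) m z.2 +
            ∑ m', ∑' s : HAR.past t₀ z.2 (X.S m' z.1), HAR.clusterFun G M m m' s z.2)) ∧
    -- the cluster functions are 1-periodic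
    (∀ (m m₀ : N) (s t : ℝ), s < t →
      HAR.clusterFun G M m m₀ (s + 1) (t + 1) = HAR.clusterFun G M m m₀ s t) ∧
    -- the bound on their `L¹` norms
    (M.Spec1 G → M.Spec11 G) ∧
    (M.Spec11 G → ∀ (m m₀ : N) (s : ℝ),
      ∫⁻ t in Set.Ioi s, HAR.clusterFun G M m m₀ s t ≤
        HAR.normL1 (M.h (Sum.inl m) (Sum.inl m₀)) +
          ∑ p, ∑ p', (G.n p : ENNReal) * ENNReal.ofReal (M.a (Sum.inl m) p) *
            HAR.normL1 (M.h (Sum.inl m) (Sum.inr p)) *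
            ENNReal.ofReal (((1 - M.HWW G)⁻¹ : Matrix P P ℝ) p p') *
            HAR.normLattice (M.h (Sum.inr p') (Sum.inl m₀)) 1) := by
  obtain ⟨process, cluster⟩ := theorem4p5_general Pr G π ξ hdriving.history_le M hM hξ
  exact ⟨fun t₀ X hX _ hbot => process t₀ X hX fun h₀ =>
    ⟨(hbot h₀).1.spec11, (hbot h₀).2.2.2⟩, cluster⟩
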